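/- Let $\mathbb K$ be a field. A DGCA over $\mathbb K$ is a unital, associative, graded commutative differential graded algebra $(\mathcal A^*,d)$, graded in nonnegative degrees, with $d$ of degree $+1$. A Poincaré DGCA of degree $n$ is a DGCA $\mathcal A^*=\bigoplus_{k=0}^n\mathcal A^k$ with finite dimensional cohomology $H^*(\mathcal A)$, together with a functional $\int\in (H^n(\mathcal A))^\vee$ such that the pairing on $H^*(\mathcal A)$ given on homogeneous elements by $\langle\alpha,\beta\rangle=\int\alpha\cdot\beta$ if $\deg\alpha+\deg\beta=n$, and $0$ otherwise, is non-degenerate. It induces a pairing on $\mathcal A^*$ by $\langle\alpha,\beta\rangle=\int[\alpha\cdot\beta]$ if $\deg\alpha+\deg\beta=n$, and $0$ otherwise. A Hodge homotopy on $\mathcal A^*$ is a linear operator $d^-$ of degree $-1$ such that $d^-d^-=0$, $d^-dd^-=d^-$, $dd^-d=d$, $\langle \mathrm{Im}\,d^-,\mathrm{Im}\,d^-\rangle=0$ and $\langle\mathrm{Im}\,\pi_{\mathcal H},\mathrm{Im}\,d^-\rangle=0$, where $\pi_{\mathcal H}=\mathrm{id}-(dd^-+d^-d)$; its harmonic subspace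 is the graded subspace $\mathcal H^*=\mathrm{Im}\,\pi_{\mathcal H}\subseteq\mathcal A^*$. For $r\ge 2$, $\mathcal A^*$ is $(r-1)$-connected if $H^0(\mathcal A)=\mathbb K$ and $H^k(\mathcal A)=0$ for $1\le k\le r-1$. A $C_\infty$-algebra is an $A_\infty$-algebra $(V^*,m_1,m_2,\dots)$, with $m_k$ of degree $2-k$, whose operations $m_k$, $k\ge2$, vanish on (signed) shuffles; it is minimal if $m_1=0$, and unital with unit $1\in V^0$ if $m_1(1)=0$, $m_2(1,a)=m_2(a,1)=a$ and $m_k(\dots,1,\dots)=0$ for $k\ge 3$. A DGCA is a unital $C_\infty$-algebra with $m_1=d$, $m_2$ the product, and $m_k=0$ for $k\ge3$. A (unital) $C_\infty$-quasi-isomorphism is an $A_\infty$-morphism $(f_k)_{k\ge1}$, with $f_k$ of degree $1-k$, such that $f_k$ vanishes on shuffles for $k\ge2$, $f_1$ induces an isomorphism on cohomology, $f_1(1)=1$, and $f_k(\dots,1,\dots)=0$ for $k\ge2$. A DGCA is formal if it is connected to its cohomology algebra, with zero differential, by a finite zig-zag of quasi-isomorphisms of DGCAs. **Theorem.** Let $r\ge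 2$ and $\ell\ge 4$, and let $\mathcal A^*$ be an $(r-1)$-connected Poincaré DGCA of degree $n\le \ell(r-1)+2$ endowed with a Hodge homotopy $d^-$, with harmonic subspace $\mathcal H^*$. Then $\mathcal H^*$ carries a minimal unital $C_\infty$-algebra structure $(m_k)_{k\ge 2}$, with unit $1\in\mathcal H^0$ the unit of $\mathcal A^*$, such that: 1. there is a unital $C_\infty$-quasi-isomorphism from $(\mathcal H^*,(m_k))$ to $\mathcal A^*$; 2. $m_2(\alpha,\beta)=\pi_{\mathcal H}(\alpha\cdot\beta)$ for all $\alpha,\beta\in\mathcal H^*$; 3. $m_k=0$ for all $k\ge\ell-1$; 4. $m_k=0$ for all $k\ge 5$ if $n\le 6r-4$; $m_k=0$ for all $k\ge4$ if $n\le 5r-3$; and $m_k=0$ for all $k\ge 3$ if $n\le 4r-2$. Moreover, if $n\le 4r-2$, then $\mathcal A^*$ is formal. -/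

import Mathlib

universe u v w

open DirectSum

/-! ## Differential graded commutative algebras -/

/-- A unital differential graded commutative algebra over `K` (cohomological grading, concentrated
in nonnegative degrees). The total space is `carrier`, and `gr k` is its degree `k` part. -/
structure DGCA (K : Type u) [Field K] where
  carrier : Type v
  [ring : Ring carrier]
  [algebra : Algebra K carrier]
  gr : ℤ → Submodule K carrier
  [graded : GradedAlgebra gr]
  d : carrier →ₗ[K] carrier
  gr_neg : ∀ i : ℤ, i < 0 → gr i = ⊥
  mul_comm_gr : ∀ (i j : ℤ) (a b : carrier), a ∈ gr i → b ∈ gr j →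
    a * b = (i * j).negOnePow • (b * a)
  d_mem : ∀ (i : ℤ) (a : carrier), a ∈ gr i → d a ∈ gr (i + 1)
  d_d : ∀ a : carrier, d (d a) = 0
  leibniz : ∀ (i : ℤ) (a b : carrier), a ∈ gr i →
    d (a * b) = d a * b + i.negOnePow • (a * d b)

attribute [instance] DGCA.ring DGCA.algebra DGCA.graded

/-- A linear map `φ` between complexes `(V, d)` and `(W, d')` induces a bijection
`ker d / im d → ker d' / im d'` (injectivity and surjectivity are spelled out). -/
structure InducesIsoOnCohomology {K : Type u} [Field K] {V : Type v} {W : Type w}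
    [AddCommGroup V] [Module K V] [AddCommGroup W] [Module K W]
    (d : V →ₗ[K] V) (d' : W →ₗ[K] W) (φ : V →ₗ[K] W) : Prop where
  chain_map : ∀ x, φ (d x) = d' (φ x)
  injective : ∀ x, d x = 0 → (∃ y, d' y = φ x) → ∃ z, d z = x
  surjective : ∀ y, d' y = 0 → ∃ x, d x = 0 ∧ ∃ z, d' z = y - φ x

namespace DGCA

variable {K : Type u} [Field K]

section Cohomology

variable (A : DGCA.{u, v} K)

/-- The degree `i` component, as a linear map `A → A^i`. -/
noncomputable def component (i : ℤ) : A.carrier →ₗ[K] A.gr i :=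
  DirectSum.component K ℤ (fun i => A.gr i) i ∘ₗ (decomposeLinearEquiv A.gr).toLinearMap

theorem component_apply (i : ℤ) (a : A.carrier) :
    A.component i a = decompose A.gr a i := rfl

theorem d_one : A.d 1 = 0 := by
  have h := A.leibniz 0 1 1 (SetLike.GradedOne.one_mem)
  simpa using h

theorem d_component (i : ℤ) (a : A.carrier) :
    A.d (A.component i a) = A.component (i + 1) (A.d a) := by
  simp only [component_apply]
  induction a using Decomposition.inductionOn A.gr with
  | zero => simp
  | @homogeneous j m =>
    by_cases h : j = i
    · subst h
      rw [decompose_of_mem_same _ m.2, decompose_of_mem_same _ (A.d_mem _ _ m.2)]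
    · rw [decompose_of_mem_ne _ m.2 h, map_zero,
        decompose_of_mem_ne _ (A.d_mem _ _ m.2) (by omega)]
  | add m m' h h' =>
    simp only [map_add, decompose_add, DirectSum.add_apply, Submodule.coe_add, h, h']

theorem d_mul_of_closed (a b : A.carrier) (hb : A.d b = 0) : A.d (a * b) = A.d a * b := by
  induction a using Decomposition.inductionOn A.gr with
  | zero => simp
  | @homogeneous j m => simp [A.leibniz j m b m.2, hb]
  | add m m' h h' => simp only [add_mul, map_add, h, h']

theorem exists_d_eq_mul (z c : A.carrier) (hz : A.d z = 0) : ∃ e, A.d e = z * A.d c := by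
  classical
  refine ⟨∑ i ∈ (decompose A.gr z).support,
    i.negOnePow • ((decompose A.gr z i : A.carrier) * c), ?_⟩
  conv_rhs => rw [← sum_support_decompose A.gr z]
  rw [map_sum, Finset.sum_mul]
  refine Finset.sum_congr rfl fun i _ => ?_
  have hzi : A.d (decompose A.gr z i : A.carrier) = 0 := by
    have := A.d_component i z
    rw [hz, map_zero] at this
    exact this
  rw [Units.smul_def, map_zsmul, A.leibniz i _ c (decompose A.gr z i).2, hzi, zero_mul, zero_add,
    ← Units.smul_def, smul_smul, Int.units_mul_self, one_smul]

/-- The algebra of cocycles `ker d`. -/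
def cocycles : Subalgebra K A.carrier where
  carrier := {a | A.d a = 0}
  mul_mem' := by
    intro a b ha hb
    simp only [Set.mem_ofPred_eq] at *
    rw [A.d_mul_of_closed a b hb, ha, zero_mul]
  add_mem' := by
    intro a b ha hb
    simp only [Set.mem_ofPred_eq] at *
    rw [map_add, ha, hb, add_zero]
  algebraMap_mem' := by
    intro c
    simp only [Set.mem_ofPred_eq]
    rw [Algebra.algebraMap_eq_smul_one, map_smul, A.d_one, smul_zero]

/-- The ideal of coboundaries `im d` in `ker d`. -/
def coboundaries : Ideal A.cocycles where
  carrier := {z | ∃ c, A.d c = z}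
  add_mem' := by
    rintro a b ⟨c, hc⟩ ⟨e, he⟩
    exact ⟨c + e, by rw [map_add, hc, he]; rfl⟩
  zero_mem' := ⟨0, by simp⟩
  smul_mem' := by
    rintro z b ⟨c, hc⟩
    obtain ⟨e, he⟩ := A.exists_d_eq_mul z c z.2
    exact ⟨e, by rw [he, hc]; rfl⟩

instance : A.coboundaries.IsTwoSided where
  mul_mem_of_left := by
    rintro a b ⟨c, hc⟩
    exact ⟨c * b, by rw [A.d_mul_of_closed c b b.2, hc]; rfl⟩

/-- The total cohomology algebra `H(A) = ker d / im d`. -/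
def Coh : Type v := A.cocycles ⧸ A.coboundaries

noncomputable instance : Ring A.Coh := inferInstanceAs (Ring (A.cocycles ⧸ A.coboundaries))

noncomputable instance : Algebra K A.Coh :=
  inferInstanceAs (Algebra K (A.cocycles ⧸ A.coboundaries))

/-- The projection `ker d → H(A)`. -/
noncomputable def cls : A.cocycles →ₐ[K] A.Coh := Ideal.Quotient.mkₐ K A.coboundaries

theorem cls_surjective : Function.Surjective A.cls := Ideal.Quotient.mkₐ_surjective K _

theorem cls_eq_zero_iff (z : A.cocycles) : A.cls z = 0 ↔ ∃ c, A.d c = z :=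
  Ideal.Quotient.eq_zero_iff_mem

/-- `H^k(A)`: the classes of the cocycles of degree `k`. -/
noncomputable def cohGr (k : ℤ) : Submodule K A.Coh :=
  ((A.gr k).comap A.cocycles.val.toLinearMap).map A.cls.toLinearMap

theorem mem_cohGr {k : ℤ} {x : A.Coh} :
    x ∈ A.cohGr k ↔ ∃ z : A.cocycles, (z : A.carrier) ∈ A.gr k ∧ A.cls z = x := Iff.rfl

/-- The degree `k` component of a cocycle, as a cocycle. -/
noncomputable def cocycleProj (k : ℤ) : A.cocycles →ₗ[K] A.cocycles where
  toFun z := ⟨A.component k z, by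
    change A.d _ = 0
    rw [A.d_component, show A.d (z : A.carrier) = 0 from z.2, map_zero]; rfl⟩
  map_add' a b := by ext; simp
  map_smul' c a := by ext; simp

/-- The projection of `H(A)` on its degree `k` part. -/
noncomputable def cohProj (k : ℤ) : A.Coh →ₗ[K] A.Coh :=
  Submodule.liftQ (A.coboundaries.restrictScalars K) (A.cls.toLinearMap ∘ₗ A.cocycleProj k) (by
    rintro z ⟨c, hc⟩
    refine (A.cls_eq_zero_iff _).2 ⟨A.component (k - 1) c, ?_⟩
    change _ = ((A.component k z : A.gr k) : A.carrier)
    rw [A.d_component, hc, sub_add_cancel])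

theorem cohProj_cls (k : ℤ) (z : A.cocycles) :
    A.cohProj k (A.cls z) = A.cls (A.cocycleProj k z) := rfl

theorem cohProj_of_mem {i : ℤ} (k : ℤ) {x : A.Coh} (hx : x ∈ A.cohGr i) :
    A.cohProj k x = if i = k then x else 0 := by
  obtain ⟨z, hz, rfl⟩ := A.mem_cohGr.1 hx
  rw [cohProj_cls]
  split_ifs with h
  · subst h
    congr 1
    ext
    exact decompose_of_mem_same _ hz
  · rw [show A.cocycleProj k z = 0 from Subtype.ext (decompose_of_mem_ne _ hz h), map_zero]

theorem cohGr_isInternal : DirectSum.IsInternal A.cohGr := by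
  classical
  constructor
  · rw [injective_iff_map_eq_zero]
    intro x hx
    have key : ∀ (k : ℤ) (y : ⨁ i, A.cohGr i),
        A.cohProj k (DirectSum.coeAddMonoidHom A.cohGr y) = y k := by
      intro k y
      induction y using DirectSum.induction_on with
      | zero => simp
      | of i y =>
        rw [DirectSum.coeAddMonoidHom_of, A.cohProj_of_mem k y.2]
        split_ifs with h
        · subst h; simp
        · rw [DirectSum.of_eq_of_ne _ _ _ (Ne.symm h)]; rfl
      | add y y' h h' => simp only [map_add, h, h', DirectSum.add_apply, Submodule.coe_add]
    ext k
    rw [← key k x, hx, map_zero]; rfl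
  · intro x
    obtain ⟨z, rfl⟩ := A.cls_surjective x
    have hz : z = ∑ i ∈ (decompose A.gr (z : A.carrier)).support, A.cocycleProj i z := by
      ext
      rw [AddSubmonoidClass.coe_finsetSum]
      exact (sum_support_decompose A.gr (z : A.carrier)).symm
    refine ⟨∑ i ∈ (decompose A.gr (z : A.carrier)).support,
      DirectSum.of (fun i => A.cohGr i) i
        ⟨A.cls (A.cocycleProj i z), A.mem_cohGr.2 ⟨_, (A.component i z).2, rfl⟩⟩, ?_⟩
    rw [map_sum]
    simp only [DirectSum.coeAddMonoidHom_of]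
    conv_rhs => rw [hz, map_sum]

instance : SetLike.GradedMonoid A.cohGr where
  one_mem := ⟨1, SetLike.GradedOne.one_mem (A := A.gr), map_one A.cls⟩
  mul_mem := by
    rintro i j _ _ ⟨z, hz, rfl⟩ ⟨z', hz', rfl⟩
    exact ⟨z * z', SetLike.GradedMul.mul_mem (A := A.gr) hz hz', map_mul A.cls z z'⟩

noncomputable instance : DirectSum.Decomposition A.cohGr :=
  A.cohGr_isInternal.chooseDecomposition

noncomputable instance : GradedAlgebra A.cohGr where

/-- The cohomology algebra `H(A)`, as a DGCA with zero differential. -/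
noncomputable def cohomology : DGCA.{u, v} K where
  carrier := A.Coh
  gr := A.cohGr
  d := 0
  gr_neg := by
    intro i hi
    rw [eq_bot_iff]
    rintro _ ⟨z, hz, rfl⟩
    have hz' : (z : A.carrier) ∈ A.gr i := hz
    rw [A.gr_neg i hi, Submodule.mem_bot] at hz'
    rw [show z = 0 from Subtype.ext hz']
    simp
  mul_comm_gr := by
    rintro i j _ _ ⟨z, hz, rfl⟩ ⟨z', hz', rfl⟩
    change A.cls z * A.cls z' = _ • (A.cls z' * A.cls z)
    rw [← map_mul, ← map_mul, Units.smul_def, ← map_zsmul]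
    congr 1
    ext
    have := A.mul_comm_gr i j z z' hz hz'
    rw [Units.smul_def] at this
    simpa using this
  d_mem := by intro i a _; simp
  d_d := by intro a; simp
  leibniz := by intro i a b _; simp

end Cohomology

/-- Morphisms of DGCAs: unital algebra morphisms that preserve degrees and commute with the
differentials. -/
structure Hom (A B : DGCA.{u, v} K) where
  toAlgHom : A.carrier →ₐ[K] B.carrier
  map_gr : ∀ (i : ℤ) (a : A.carrier), a ∈ A.gr i → toAlgHom a ∈ B.gr i
  map_d : ∀ a : A.carrier, toAlgHom (A.d a) = B.d (toAlgHom a)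

/-- `A` and `B` are joined by a quasi-isomorphism of DGCAs `A → B`. -/
def HasQuasiIso (A B : DGCA.{u, v} K) : Prop :=
  ∃ φ : Hom A B, InducesIsoOnCohomology A.d B.d φ.toAlgHom.toLinearMap

/-- Weak (homotopy) equivalence: a finite zig-zag of quasi-isomorphisms of DGCAs. -/
def WeaklyEquivalent (A B : DGCA.{u, v} K) : Prop := Relation.EqvGen HasQuasiIso A B

/-- `A` is formal: weakly equivalent to its cohomology algebra with zero differential. -/
def IsFormal (A : DGCA.{u, v} K) : Prop := A.WeaklyEquivalent A.cohomology

/-- `A` is (homologically) `c`-connected: `H^0(A) = K` and `H^k(A) = 0` for `1 ≤ k ≤ c`. -/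
structure IsConnected (A : DGCA.{u, v} K) (c : ℕ) : Prop where
  zero : ∀ x ∈ A.cohGr 0, ∃! t : K, algebraMap K A.Coh t = x
  pos : ∀ k : ℕ, 1 ≤ k → k ≤ c → A.cohGr k = ⊥

end DGCA

/-! ## Poincaré DGCAs and Hodge homotopies -/

/-- A Poincaré DGCA of degree `n`: `A = ⊕_{0 ≤ k ≤ n} A^k`, with finite dimensional cohomology and a
fundamental class `∫ ∈ (H^n)^∨` such that the pairing on `H(A)` which sends `(α, β)` to `∫` of the
degree `n` component of `α β` is non-degenerate. -/
structure PoincareDGCA (K : Type u) [Field K] (n : ℕ) extends DGCA.{u, v} K where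
  gr_above : ∀ i : ℤ, n < i → gr i = ⊥
  finite_coh : Module.Finite K toDGCA.Coh
  integral : toDGCA.cohGr n →ₗ[K] K
  nondegenerate : ∀ α : toDGCA.Coh,
    (∀ β : toDGCA.Coh, integral (decompose toDGCA.cohGr (α * β) n) = 0) → α = 0

namespace PoincareDGCA

variable {K : Type u} [Field K] {n : ℕ} (A : PoincareDGCA.{u, v} K n)

/-- The projection `[·] : A^n → H^n(A)`; every element of `A^n` is closed since `A^{n+1} = 0`. -/
noncomputable def topClass : A.gr n →ₗ[K] A.cohGr n where
  toFun a := ⟨A.cls ⟨a, by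
    have h := A.d_mem n a a.2
    rw [A.gr_above (n + 1) (by omega)] at h
    exact h⟩, ⟨_, a.2, rfl⟩⟩
  map_add' a b := Subtype.ext (map_add A.cls ⟨a, _⟩ ⟨b, _⟩)
  map_smul' c a := Subtype.ext (map_smul A.cls c ⟨a, _⟩)

/-- The induced pairing on `A`: for `α` of degree `k` and `β` of degree `l` it is `∫ [α β]` if
`k + l = n`, and `0` otherwise. -/
noncomputable def pairing (a b : A.carrier) : K :=
  A.integral (A.topClass (A.component n (a * b)))

/-- A Hodge homotopy: a degree `-1` operator `δ` (written `d⁻` in the literature). -/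
structure HodgeHomotopy where
  δ : A.carrier →ₗ[K] A.carrier
  δ_mem : ∀ (i : ℤ) (a : A.carrier), a ∈ A.gr i → δ a ∈ A.gr (i - 1)
  δ_δ : ∀ a, δ (δ a) = 0
  δ_d_δ : ∀ a, δ (A.d (δ a)) = δ a
  d_δ_d : ∀ a, A.d (δ (A.d a)) = A.d a
  pairing_δ_δ : ∀ a b, A.pairing (δ a) (δ b) = 0
  pairing_harmonic_δ : ∀ a b, A.pairing (a - (A.d (δ a) + δ (A.d a))) (δ b) = 0

namespace HodgeHomotopy

variable {A} (h : A.HodgeHomotopy)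

/-- `π_H = id - [d, d⁻]`, with `[d, d⁻] = d d⁻ + d⁻ d` the graded commutator. -/
def proj : A.carrier →ₗ[K] A.carrier :=
  LinearMap.id - (A.d ∘ₗ h.δ + h.δ ∘ₗ A.d)

/-- The harmonic subspace `H = Im π_H`. -/
def harmonic : Submodule K A.carrier := LinearMap.range h.proj

/-- `π_H` with values in the harmonic subspace. -/
def toHarmonic : A.carrier →ₗ[K] h.harmonic := h.proj.rangeRestrict

/-- The grading of the harmonic subspace, `H^k = H ∩ A^k`. -/
def harmonicGr (k : ℤ) : Submodule K h.harmonic := (A.gr k).comap h.harmonic.subtype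

theorem proj_one : h.proj 1 = 1 := by
  have h1 : h.δ 1 = 0 := by
    have := h.δ_mem 0 1 SetLike.GradedOne.one_mem
    rw [A.gr_neg (0 - 1) (by omega)] at this
    exact this
  simp [proj, h1, A.d_one]

/-- The unit of `A`, as an element of the harmonic subspace. -/
def harmonicOne : h.harmonic := ⟨1, 1, h.proj_one⟩

end HodgeHomotopy

end PoincareDGCA

/-! ## `C∞`-algebras -/

section CInfinity

variable (K : Type u) [Field K]

/-- A family of multilinear operations `V^{⊗k} → W`, one for each arity `k`. Only the arities
`k ≥ 1` matter; below, the operation of arity `0` is required to vanish. -/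
abbrev Operations (V : Type v) (W : Type w) [AddCommGroup V] [Module K V]
    [AddCommGroup W] [Module K W] :=
  (k : ℕ) → MultilinearMap K (fun _ : Fin k => V) W

variable {K} {V : Type v} {W : Type w} [AddCommGroup V] [Module K V] [AddCommGroup W] [Module K W]

/-- The unary operation, as a linear map. -/
def Operations.unary (f : Operations K V W) : V →ₗ[K] W :=
  (MultilinearMap.ofSubsingleton K V W (0 : Fin 1)).symm (f 1)

/-- The arguments `(a_0, …, a_{l-1}, m_k(a_l, …, a_{l+k-1}), a_{l+k}, …)`. -/
def insertOp (m : Operations K V V) (a : ℕ → V) (l k i : ℕ) : V :=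
  if i < l then a i else if i = l then m k (fun j => a (l + j)) else a (i + k - 1)

/-- `σ` is a `(p, q)`-shuffle: it is increasing on the first `p` and on the last `q` indices. -/
def IsShuffle (p q : ℕ) (σ : Equiv.Perm (Fin (p + q))) : Prop :=
  StrictMonoOn σ {i | (i : ℕ) < p} ∧ StrictMonoOn σ {i | p ≤ (i : ℕ)}

/-- The exponent of the sign `sgn(σ) ε(σ; a)` (with `ε` the Koszul sign) of the permutation which
moves the `i`-th argument, of degree `deg i`, to the position `σ i`. -/
def shuffleExponent {k : ℕ} (σ : Equiv.Perm (Fin k)) (deg : Fin k → ℤ) : ℤ :=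
  ∑ i, ∑ j, if i < j ∧ σ j < σ i then 1 + deg i * deg j else 0

open Classical in
/-- The operations of arity `≥ 2` vanish on all (signed) shuffle products of tensors. -/
def VanishesOnShuffles (𝒱 : ℤ → Submodule K V) (f : Operations K V W) : Prop :=
  ∀ p q : ℕ, 1 ≤ p → 1 ≤ q → ∀ (deg : Fin (p + q) → ℤ) (a : Fin (p + q) → V),
    (∀ i, a i ∈ 𝒱 (deg i)) →
    ∑ σ : Equiv.Perm (Fin (p + q)) with IsShuffle p q σ,
      (shuffleExponent σ deg).negOnePow • f (p + q) (fun i => a (σ.symm i)) = 0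

/-- The operations `m_k`, `k ≥ 1`, of degree `2 - k`, form a `C∞`-algebra structure on the graded
vector space `V = ⊕ 𝒱 i`, that is, an `A∞`-algebra structure that vanishes on shuffles. The Stasheff
identities `∑ (-1)^{l + k t} m_{l+1+t} (1^{⊗l} ⊗ m_k ⊗ 1^{⊗t}) = 0` are evaluated on homogeneous
elements, with the Koszul sign `k (|a_0| + ⋯ + |a_{l-1}|)`. -/
structure IsCInfinityAlgebra (𝒱 : ℤ → Submodule K V) (m : Operations K V V) : Prop where
  isInternal : DirectSum.IsInternal 𝒱
  zero : m 0 = 0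
  degree : ∀ (k : ℕ) (deg : Fin k → ℤ) (a : Fin k → V), (∀ i, a i ∈ 𝒱 (deg i)) →
    m k a ∈ 𝒱 ((∑ i, deg i) + 2 - k)
  stasheff : ∀ (p : ℕ) (deg : ℕ → ℤ) (a : ℕ → V), 1 ≤ p → (∀ i, a i ∈ 𝒱 (deg i)) →
    ∑ k ∈ Finset.Icc 1 p, ∑ l ∈ Finset.range (p - k + 1),
      ((l : ℤ) + k * (p - l - k) + k * ∑ i ∈ Finset.range l, deg i).negOnePow •
        m (p - k + 1) (fun i => insertOp m a l k i) = 0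
  shuffle : VanishesOnShuffles 𝒱 m

/-- Minimality: the unary operation is zero. -/
def IsMinimal (m : Operations K V V) : Prop := m 1 = 0

/-- `e`, of degree `0`, is a strict unit. -/
structure IsUnital (𝒱 : ℤ → Submodule K V) (m : Operations K V V) (e : V) : Prop where
  mem : e ∈ 𝒱 0
  unary : m 1 ![e] = 0
  left : ∀ a, m 2 ![e, a] = a
  right : ∀ a, m 2 ![a, e] = a
  higher : ∀ k, 3 ≤ k → ∀ a : Fin k → V, (∃ i, a i = e) → m k a = 0

/-- The exponent of the sign of the term `m'_r (f_{c_0} ⊗ ⋯ ⊗ f_{c_{r-1}})` in the equations of an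
`A∞`-morphism: for each pair of blocks `α < β` it collects `1 - c_α`, and the Koszul sign
`(1 - c_β) |block α|` of moving `f_{c_β}` past the arguments in block `α`. -/
def morphismExponent {p : ℕ} (c : Composition p) (deg : ℕ → ℤ) : ℤ :=
  ∑ α : Fin c.length, ∑ β : Fin c.length, if α < β then
    (1 - (c.blocksFun α : ℤ)) +
      (1 - (c.blocksFun β : ℤ)) * ∑ j ∈ Finset.range (c.blocksFun α), deg (c.sizeUpTo α + j)
  else 0

/-- The maps `f_k`, `k ≥ 1`, of degree `1 - k`, form a `C∞`-morphism `(V, m) → (W, m')`, that is, an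
`A∞`-morphism that vanishes on shuffles:
`∑ (-1)^{l + k t} f_{l+1+t} (1^{⊗l} ⊗ m_k ⊗ 1^{⊗t}) = ∑ ± m'_r (f_{c_0} ⊗ ⋯ ⊗ f_{c_{r-1}})`, where the
second sum runs over the compositions `c_0 + ⋯ + c_{r-1} = p`. -/
structure IsCInfinityMorphism (𝒱 : ℤ → Submodule K V) (m : Operations K V V)
    (𝒲 : ℤ → Submodule K W) (m' : Operations K W W) (f : Operations K V W) : Prop where
  zero : f 0 = 0
  degree : ∀ (k : ℕ) (deg : Fin k → ℤ) (a : Fin k → V), (∀ i, a i ∈ 𝒱 (deg i)) →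
    f k a ∈ 𝒲 ((∑ i, deg i) + 1 - k)
  equation : ∀ (p : ℕ) (deg : ℕ → ℤ) (a : ℕ → V), 1 ≤ p → (∀ i, a i ∈ 𝒱 (deg i)) →
    ∑ k ∈ Finset.Icc 1 p, ∑ l ∈ Finset.range (p - k + 1),
      ((l : ℤ) + k * (p - l - k) + k * ∑ i ∈ Finset.range l, deg i).negOnePow •
        f (p - k + 1) (fun i => insertOp m a l k i) =
    ∑ c : Composition p, (morphismExponent c deg).negOnePow •
      m' c.length (fun α => f (c.blocksFun α) (fun j => a (c.sizeUpTo α + j)))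
  shuffle : VanishesOnShuffles 𝒱 f

/-- Unital morphisms: `f_1` sends the unit to the unit, and `f_k`, `k ≥ 2`, vanishes when one of its
arguments is the unit. -/
structure IsUnitalMorphism (f : Operations K V W) (e : V) (e' : W) : Prop where
  unary : f 1 ![e] = e'
  higher : ∀ k, 2 ≤ k → ∀ a : Fin k → V, (∃ i, a i = e) → f k a = 0

/-- A unital `C∞`-quasi-isomorphism: a unital `C∞`-morphism `f` whose linear part `f_1` induces an
isomorphism on the cohomology with respect to the unary operations. -/
structure IsUnitalCInfinityQuasiIso (𝒱 : ℤ → Submodule K V) (m : Operations K V V) (e : V)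
    (𝒲 : ℤ → Submodule K W) (m' : Operations K W W) (e' : W) (f : Operations K V W) : Prop where
  isMorphism : IsCInfinityMorphism 𝒱 m 𝒲 m' f
  isUnital : IsUnitalMorphism f e e'
  quasiIso : InducesIsoOnCohomology m.unary m'.unary f.unary

end CInfinity

/-- A DGCA as a `C∞`-algebra: `m_1 = d`, `m_2` is the product, and `m_k = 0` for `k ≥ 3`. -/
def DGCA.operations {K : Type u} [Field K] (A : DGCA.{u, v} K) :
    Operations K A.carrier A.carrier
  | 1 => A.d.compMultilinearMap (MultilinearMap.mkPiAlgebraFin K 1 A.carrier)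
  | 2 => MultilinearMap.mkPiAlgebraFin K 2 A.carrier
  | _ => 0

/-!
The `C∞`-structure on the harmonic subspace `H` is obtained by homotopy transfer, written without
trees. Functions of words in `H` with values in `A` form a convolution algebra; let `F` be the
fixed point of `F = letter - δ ∘ cupSq F`, where `letter` is the inclusion `H → A` and `cupSq F` is
the convolution square of `F` for the Koszul signs (`twisting`, `twisting_eq`). With
`M = π_H ∘ cupSq F` (`transferred`), the coderivation of the tensor coalgebra with corestriction `M`
acts on convolution products as a derivation (`insertSum_cupSq`). It follows that the defect
`D = F ∘ b_M - d ∘ F - cupSq F` of the Maurer-Cartan equation satisfies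
`D = -δ (∑ ± D(s) F(t) - F(s) D(t))`, so `D = 0` by induction on the length of words
(`defect_eq_zero`). This is the morphism equation for `F`, and applying `π_H` to
`cupSq F ∘ b_M = -d ∘ cupSq F` gives the Stasheff identities for `M` (`insertSum_transferred`).

By multiplicativity of deconcatenation for the shuffle product (`shuffleSum_splitSum`), only two
terms survive in the value of `cupSq F` on a shuffle of two nonempty words, and they cancel since
`A` is graded commutative; this gives the vanishing on shuffles over any field
(`shuffleSum_cupSq`). The usual sign conventions are recovered by desuspension
(`IsSlotLinear.operations`, `insertOp_term`, `shuffleSum_suspExponent`).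

For the vanishing of `m_k`, `k ≥ 3`, multiples of the unit may be excluded from the arguments, so
that all of them have degree at least `r` and the value has degree at least `k (r - 1) + 2`. By
Poincaré duality `H` vanishes in the degrees `n - r + 1, …, n - 1`, so for
`n ≤ (k + 1) (r - 1) + 2` only the top degree is left. There the integral of the value is a sum of
pairings of elements of `Im δ` with elements of `Im δ` or `H`, hence zero (`transferred_eq_zero`).

For formality, the elements which are harmonic up to degree `2 r - 2` and lie in `ker δ` in degree
`2 r - 1` form a quasi-isomorphic sub-DGCA `B` of `A`. If `n ≤ 4 r - 2`, then `π_H` is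
multiplicative on `B` (`proj_mul`), so that `A ← B → H(A)` is a zig-zag of
quasi-isomorphisms (`isFormal`).
-/

/-! ### The degree involution, harmonic elements and the pairing -/

namespace DGCA

variable {K : Type u} [Field K] (A : DGCA.{u, v} K)

/-- The degree involution `a ↦ (-1)^{deg a} a`. -/
noncomputable def parity : A.carrier →ₗ[K] A.carrier :=
  DirectSum.toModule K ℤ A.carrier (fun i => (i.negOnePow : ℤ) • (A.gr i).subtype) ∘ₗ
    (decomposeLinearEquiv A.gr).toLinearMap

variable {A}

theorem parity_of_mem {i : ℤ} {a : A.carrier} (ha : a ∈ A.gr i) :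
    A.parity a = i.negOnePow • a := by
  lift a to A.gr i using ha
  simp only [parity, LinearMap.comp_apply, LinearEquiv.coe_coe, decomposeLinearEquiv_apply,
    decompose_coe]
  rw [← DirectSum.lof_eq_of K, DirectSum.toModule_lof]
  rfl

theorem parity_mem {i : ℤ} {a : A.carrier} (ha : a ∈ A.gr i) : A.parity a ∈ A.gr i := by
  rw [parity_of_mem ha, Units.smul_def]
  exact zsmul_mem ha _

variable (A) in
@[simp] theorem parity_one : A.parity 1 = 1 := by
  rw [parity_of_mem (i := 0) SetLike.GradedOne.one_mem]; simp

theorem parity_parity (a : A.carrier) : A.parity (A.parity a) = a := by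
  induction a using Decomposition.inductionOn A.gr with
  | zero => simp
  | @homogeneous j m =>
    rw [parity_of_mem (parity_mem m.2), parity_of_mem m.2, smul_smul, Int.units_mul_self, one_smul]
  | add m m' h h' => simp only [map_add, h, h']

theorem parity_mul (a b : A.carrier) : A.parity (a * b) = A.parity a * A.parity b := by
  induction a using Decomposition.inductionOn A.gr with
  | zero => simp
  | @homogeneous i m =>
    induction b using Decomposition.inductionOn A.gr with
    | zero => simp
    | @homogeneous j m' =>
      rw [parity_of_mem (SetLike.GradedMul.mul_mem m.2 m'.2), parity_of_mem m.2,
        parity_of_mem m'.2, Int.negOnePow_add, smul_mul_smul_comm]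
    | add m m' h h' => simp only [map_add, mul_add, h, h']
  | add m m' h h' => simp only [map_add, add_mul, h, h']

theorem parity_d (a : A.carrier) : A.parity (A.d a) = -A.d (A.parity a) := by
  induction a using Decomposition.inductionOn A.gr with
  | zero => simp
  | @homogeneous i m =>
    rw [parity_of_mem (A.d_mem _ _ m.2), parity_of_mem m.2, Int.negOnePow_succ, Units.smul_def,
      Units.smul_def, map_zsmul, Units.val_neg, neg_smul]
  | add m m' h h' => simp only [map_add, h, h', neg_add]

theorem d_mul (a b : A.carrier) : A.d (a * b) = A.d a * b + A.parity a * A.d b := by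
  induction a using Decomposition.inductionOn A.gr with
  | zero => simp
  | @homogeneous i m =>
    rw [A.leibniz i _ _ m.2, parity_of_mem m.2, smul_mul_assoc]
  | add m m' h h' => simp only [map_add, add_mul, h, h']; abel

variable (A) in
/-- A subspace which contains the homogeneous components of its elements is graded. -/
theorem isInternal_comap (p : Submodule K A.carrier)
    (hp : ∀ x ∈ p, ∀ i, (A.component i x : A.carrier) ∈ p) (ℬ : ℤ → Submodule K p)
    (hℬ : ∀ i x, x ∈ ℬ i ↔ (x : A.carrier) ∈ A.gr i) : DirectSum.IsInternal ℬ := by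
  classical
  constructor
  · have key : ∀ (k : ℤ) (y : ⨁ i, ℬ i), (A.component k
        (DirectSum.coeAddMonoidHom ℬ y : p) : A.carrier) =
          (y k : p) := by
      intro k y
      induction y using DirectSum.induction_on with
      | zero => simp
      | of i y =>
        rw [DirectSum.coeAddMonoidHom_of, component_apply]
        by_cases h : i = k
        · subst h
          rw [decompose_of_mem_same _ ((hℬ _ _).1 y.2)]; simp
        · rw [DirectSum.of_eq_of_ne _ _ _ (Ne.symm h), decompose_of_mem_ne _ ((hℬ _ _).1 y.2) h]
          rfl
      | add y y' h h' =>
        simp only [map_add, Submodule.coe_add, h, h', DirectSum.add_apply]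
    intro x y hxy
    ext k
    rw [← key k x, hxy, key k y]
  · intro x
    refine ⟨∑ i ∈ (decompose A.gr (x : A.carrier)).support,
      DirectSum.of (fun i => ℬ i) i
        ⟨⟨A.component i x, hp x x.2 i⟩, (hℬ _ _).2 (A.component i x).2⟩, ?_⟩
    rw [map_sum]
    simp only [DirectSum.coeAddMonoidHom_of]
    ext
    rw [AddSubmonoidClass.coe_finsetSum]
    exact sum_support_decompose A.gr (x : A.carrier)

end DGCA

namespace PoincareDGCA

variable {K : Type u} [Field K] {n : ℕ} {A : PoincareDGCA.{u, v} K n}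

theorem integral_injective {r : ℕ} (hA : A.IsConnected r) {x : A.Coh}
    (hx : x ∈ A.cohGr n) (h : A.integral ⟨x, hx⟩ = 0) : x = 0 := by
  refine A.nondegenerate x fun β => ?_
  have h1 : (decompose A.cohGr (x * β) n : A.Coh) = x * decompose A.cohGr β 0 := by
    conv_lhs => rw [← add_zero (n : ℤ)]
    exact DirectSum.coe_decompose_mul_add_of_left_mem A.cohGr hx
  obtain ⟨t, ht, -⟩ := hA.zero _ (decompose A.cohGr β 0).2
  have h2 : decompose A.cohGr (x * β) n = t • (⟨x, hx⟩ : A.cohGr n) := by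
    ext
    rw [h1, ← ht, Submodule.coe_smul, Algebra.algebraMap_eq_smul_one, mul_smul_comm, mul_one]
  rw [h2, map_smul, h, smul_zero]

/-- Poincaré duality for a connected algebra: the cohomology vanishes just below the top degree. -/
theorem cohGr_eq_bot {r : ℕ} (hA : A.IsConnected r) {k : ℤ} (h1 : n - r ≤ k) (h2 : k < n) :
    A.cohGr k = ⊥ := by
  rw [eq_bot_iff]
  intro x hx
  rw [Submodule.mem_bot]
  refine A.nondegenerate x fun β => ?_
  have e : (decompose A.cohGr (x * β) n : A.Coh) = x * decompose A.cohGr β (n - k) := by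
    conv_lhs => rw [← add_sub_cancel k (n : ℤ)]
    exact DirectSum.coe_decompose_mul_add_of_left_mem A.cohGr hx
  have h3 : A.cohGr (n - k) = ⊥ := by
    have := hA.pos (n - k).toNat (by omega) (by omega)
    rwa [Int.toNat_of_nonneg (by omega)] at this
  have h4 : decompose A.cohGr (x * β) n = 0 := by
    ext
    rw [e, (Submodule.eq_bot_iff _).1 h3 _ (decompose A.cohGr β (n - k)).2, mul_zero]; rfl
  rw [h4, map_zero]

theorem pairing_comm {i j : ℤ} {a b : A.carrier} (ha : a ∈ A.gr i) (hb : b ∈ A.gr j) :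
    A.pairing a b = (i * j).negOnePow • A.pairing b a := by
  rw [pairing, pairing, A.mul_comm_gr i j a b ha hb]
  simp only [Units.smul_def, map_zsmul]

theorem integral_topClass_d (a : A.carrier) :
    A.integral (A.topClass (A.component n (A.d a))) = 0 := by
  have : A.topClass (A.component n (A.d a)) = 0 := by
    ext
    refine (A.cls_eq_zero_iff _).2 ⟨A.component (n - 1) a, ?_⟩
    rw [A.d_component, sub_add_cancel]
  rw [this, map_zero]

namespace HodgeHomotopy

variable (h : A.HodgeHomotopy)

theorem proj_apply (a : A.carrier) : h.proj a = a - (A.d (h.δ a) + h.δ (A.d a)) := rfl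

theorem d_proj (a : A.carrier) : A.d (h.proj a) = 0 := by
  simp [proj_apply, A.d_d, h.d_δ_d]

theorem δ_proj (a : A.carrier) : h.δ (h.proj a) = 0 := by
  simp [proj_apply, h.δ_δ, h.δ_d_δ]

theorem proj_d (a : A.carrier) : h.proj (A.d a) = 0 := by
  simp [proj_apply, A.d_d, h.d_δ_d]

theorem proj_δ (a : A.carrier) : h.proj (h.δ a) = 0 := by
  simp [proj_apply, h.δ_δ, h.δ_d_δ]

theorem proj_proj (a : A.carrier) : h.proj (h.proj a) = h.proj a := by
  rw [proj_apply, d_proj, δ_proj]; simp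

theorem mem_harmonic_iff {a : A.carrier} : a ∈ h.harmonic ↔ h.proj a = a :=
  ⟨by rintro ⟨b, rfl⟩; exact h.proj_proj b, fun e => ⟨a, e⟩⟩

@[simp] theorem proj_coe (x : h.harmonic) : h.proj x = x := h.mem_harmonic_iff.1 x.2

@[simp] theorem d_coe (x : h.harmonic) : A.d (x : A.carrier) = 0 := by
  rw [← h.proj_coe, d_proj]

@[simp] theorem δ_coe (x : h.harmonic) : h.δ (x : A.carrier) = 0 := by
  rw [← h.proj_coe, δ_proj]

theorem parity_δ (a : A.carrier) : A.parity (h.δ a) = -h.δ (A.parity a) := by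
  induction a using Decomposition.inductionOn A.gr with
  | zero => simp
  | @homogeneous i m =>
    rw [DGCA.parity_of_mem (h.δ_mem _ _ m.2), DGCA.parity_of_mem m.2, Int.negOnePow_sub,
      Units.smul_def, Units.smul_def, map_zsmul]
    simp
  | add m m' h h' => simp only [map_add, h, h', neg_add]

theorem parity_proj (a : A.carrier) : A.parity (h.proj a) = h.proj (A.parity a) := by
  simp [proj_apply, DGCA.parity_d, parity_δ]

theorem proj_mem {i : ℤ} {a : A.carrier} (ha : a ∈ A.gr i) : h.proj a ∈ A.gr i := by
  refine sub_mem ha (add_mem ?_ ?_)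
  · simpa using A.d_mem _ _ (h.δ_mem _ _ ha)
  · simpa using h.δ_mem _ _ (A.d_mem _ _ ha)

theorem δ_component (i : ℤ) (a : A.carrier) :
    h.δ (A.component i a) = A.component (i - 1) (h.δ a) := by
  simp only [DGCA.component_apply]
  induction a using Decomposition.inductionOn A.gr with
  | zero => simp
  | @homogeneous j m =>
    by_cases e : j = i
    · subst e
      rw [decompose_of_mem_same _ m.2, decompose_of_mem_same _ (h.δ_mem _ _ m.2)]
    · rw [decompose_of_mem_ne _ m.2 e, map_zero,
        decompose_of_mem_ne _ (h.δ_mem _ _ m.2) (by omega)]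
  | add m m' h h' =>
    simp only [map_add, decompose_add, DirectSum.add_apply, Submodule.coe_add, h, h']

theorem proj_component (i : ℤ) (a : A.carrier) :
    h.proj (A.component i a) = A.component i (h.proj a) := by
  have h1 := h.δ_component (i + 1) (A.d a)
  have h2 := A.d_component (i - 1) (h.δ a)
  rw [sub_add_cancel] at h2
  rw [add_sub_cancel_right] at h1
  rw [proj_apply, proj_apply, A.d_component, h.δ_component, h1, h2, map_sub, map_add]
  rfl

theorem harmonicGr_isInternal : DirectSum.IsInternal h.harmonicGr := by
  refine A.isInternal_comap h.harmonic (fun x hx i => ?_) _ fun _ _ => Iff.rfl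
  rw [mem_harmonic_iff] at hx ⊢
  rw [proj_component, hx]

/-- The degree involution of the harmonic subspace. -/
noncomputable def harmonicParity : h.harmonic →ₗ[K] h.harmonic :=
  A.parity.restrict fun x hx => by
    rw [mem_harmonic_iff] at hx ⊢
    rw [← parity_proj, hx]

@[simp] theorem coe_harmonicParity (x : h.harmonic) :
    (h.harmonicParity x : A.carrier) = A.parity x := rfl

@[simp] theorem coe_toHarmonic (a : A.carrier) : (h.toHarmonic a : A.carrier) = h.proj a := rfl

theorem eq_zero_of_coe_eq_d {x : h.harmonic} {c : A.carrier} (hc : A.d c = x) : x = 0 := by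
  ext
  rw [← h.proj_coe, ← hc, proj_d]; rfl

theorem harmonic_eq_zero {i : ℤ} (hi : A.cohGr i = ⊥) {x : h.harmonic}
    (hx : x ∈ h.harmonicGr i) : x = 0 := by
  have h1 : A.cls ⟨x, h.d_coe x⟩ ∈ A.cohGr i := ⟨_, hx, rfl⟩
  rw [hi, Submodule.mem_bot, A.cls_eq_zero_iff] at h1
  obtain ⟨c, hc⟩ := h1
  exact h.eq_zero_of_coe_eq_d hc

/-- Harmonic elements of degree `0` in a connected algebra are multiples of the unit. -/
theorem exists_eq_smul_one {r : ℕ} (hA : A.IsConnected r) {x : h.harmonic}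
    (hx : x ∈ h.harmonicGr 0) : ∃ t : K, x = t • h.harmonicOne := by
  obtain ⟨t, ht, -⟩ := hA.zero (A.cls ⟨x, h.d_coe x⟩) ⟨_, hx, rfl⟩
  refine ⟨t, sub_eq_zero.1 ?_⟩
  have h1 : A.cls (⟨x, h.d_coe x⟩ - algebraMap K A.cocycles t) = 0 := by
    rw [map_sub, AlgHom.commutes, ht, sub_self]
  obtain ⟨c, hc⟩ := (A.cls_eq_zero_iff _).1 h1
  refine h.eq_zero_of_coe_eq_d (c := c) ?_
  rw [hc]
  change (x : A.carrier) - algebraMap K A.carrier t = x - t • (1 : A.carrier)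
  rw [Algebra.algebraMap_eq_smul_one]

/-- The integral of an element of top degree is that of its harmonic part. -/
theorem integral_proj {a : A.carrier} (ha : a ∈ A.gr n) :
    A.integral (A.topClass (A.component n (h.proj a))) =
      A.integral (A.topClass (A.component n a)) := by
  have h1 : A.d a = 0 := by
    have := A.d_mem _ _ ha
    rwa [A.gr_above _ (by omega)] at this
  rw [proj_apply, h1, map_zero, add_zero, map_sub, map_sub, map_sub, integral_topClass_d, sub_zero]

/-- A harmonic element of top degree vanishes when its integral does. -/
theorem eq_zero_of_integral_eq_zero {r : ℕ} (hA : A.IsConnected r) {x : h.harmonic}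
    (hx : x ∈ h.harmonicGr n) (h0 : A.integral (A.topClass (A.component n x)) = 0) : x = 0 := by
  have e : A.component n (x : A.carrier) = ⟨x, hx⟩ := Subtype.ext (decompose_of_mem_same _ hx)
  rw [e] at h0
  obtain ⟨c, hc⟩ := (A.cls_eq_zero_iff _).1 (integral_injective hA _ h0)
  exact h.eq_zero_of_coe_eq_d hc

theorem pairing_coe_δ (x : h.harmonic) (b : A.carrier) : A.pairing x (h.δ b) = 0 := by
  have := h.pairing_harmonic_δ x b
  rwa [← proj_apply, proj_coe] at this

theorem pairing_δ_coe {i j : ℤ} {x : h.harmonic} {b : A.carrier} (hx : x ∈ h.harmonicGr i)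
    (hb : h.δ b ∈ A.gr j) : A.pairing (h.δ b) x = 0 := by
  rw [pairing_comm hb (show (x : A.carrier) ∈ A.gr i from hx), pairing_coe_δ, smul_zero]

end HodgeHomotopy

end PoincareDGCA

/-! ### Deconcatenation of words -/

section Deconcatenation

variable {X Y W W' : Type*}

section AddCommMonoid

variable [AddCommMonoid W] [AddCommMonoid W']

/-- The sum of `g s t` over all deconcatenations `l = s ++ t`. -/
def splitSum (g : List X → List X → W) : List X → W
  | [] => g [] []
  | x :: l => g [] (x :: l) + splitSum (fun s => g (x :: s)) l

theorem splitSum_congr {g h : List X → List X → W} {l : List X}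
    (H : ∀ s t, s ++ t = l → g s t = h s t) : splitSum g l = splitSum h l := by
  induction l generalizing g h with
  | nil => exact H [] [] rfl
  | cons x l ih =>
    simp only [splitSum]
    rw [H [] (x :: l) rfl, ih fun s t hst => H (x :: s) t (by simp [hst])]

theorem splitSum_add (g h : List X → List X → W) (l : List X) :
    splitSum (fun s t => g s t + h s t) l = splitSum g l + splitSum h l := by
  induction l generalizing g h with
  | nil => rfl
  | cons x l ih => simp only [splitSum, ih]; abel

theorem map_splitSum {G : Type*} [FunLike G W W'] [AddMonoidHomClass G W W'] (φ : G)
    (g : List X → List X → W) (l : List X) :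
    φ (splitSum g l) = splitSum (fun s t => φ (g s t)) l := by
  induction l generalizing g with
  | nil => rfl
  | cons x l ih => simp only [splitSum, map_add, ih]

theorem splitSum_map (f : X → Y) (g : List Y → List Y → W) (l : List X) :
    splitSum g (l.map f) = splitSum (fun s t => g (s.map f) (t.map f)) l := by
  induction l generalizing g with
  | nil => rfl
  | cons x l ih => simp only [splitSum, List.map_cons, List.map_nil, ih]

theorem mul_splitSum {R : Type*} [NonUnitalNonAssocSemiring R] (a : R) (g : List X → List X → R)
    (l : List X) : a * splitSum g l = splitSum (fun s t => a * g s t) l :=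
  map_splitSum (AddMonoidHom.mulLeft a) g l

theorem splitSum_mul {R : Type*} [NonUnitalNonAssocSemiring R] (g : List X → List X → R) (a : R)
    (l : List X) : splitSum g l * a = splitSum (fun s t => g s t * a) l :=
  map_splitSum (AddMonoidHom.mulRight a) g l

theorem splitSum_eq_zero {g : List X → List X → W} {l : List X}
    (H : ∀ s t, s ++ t = l → g s t = 0) : splitSum g l = 0 := by
  induction l generalizing g with
  | nil => exact H [] [] rfl
  | cons x l ih =>
    simp only [splitSum]
    rw [H [] (x :: l) rfl, ih fun s t hst => H (x :: s) t (by simp [hst]), add_zero]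

theorem splitSum_assoc (g : List X → List X → List X → W) (l : List X) :
    splitSum (fun s t => splitSum (g s) t) l =
      splitSum (fun r t => splitSum (fun s s' => g s s' t) r) l := by
  induction l generalizing g with
  | nil => rfl
  | cons x l ih =>
    simp only [splitSum, splitSum_add, ih]
    abel

theorem splitSum_comm (g : List X → List X → List Y → List Y → W) (l : List X) (l' : List Y) :
    splitSum (fun s t => splitSum (g s t) l') l =
      splitSum (fun s' t' => splitSum (fun s t => g s t s' t') l) l' := by
  induction l generalizing g with
  | nil => rfl
  | cons x l ih => simp only [splitSum, splitSum_add, ih]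

theorem splitSum_eq_left_nil {g : List X → List X → W} (H : ∀ x s t, g (x :: s) t = 0)
    (l : List X) : splitSum g l = g [] l := by
  cases l with
  | nil => rfl
  | cons x l => rw [splitSum, splitSum_eq_zero fun s t _ => H x s t, add_zero]

theorem splitSum_eq_right_nil {g : List X → List X → W} (H : ∀ s y t, g s (y :: t) = 0)
    (l : List X) : splitSum g l = g l [] := by
  induction l generalizing g with
  | nil => rfl
  | cons x l ih => rw [splitSum, H, ih fun s => H (x :: s), zero_add]

theorem splitSum_append_cons (g : List X → List X → W) (u w : List X) (x : X) :
    splitSum g (u ++ x :: w) =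
      splitSum (fun s t => g s (t ++ x :: w)) u + splitSum (fun s t => g (u ++ x :: s) t) w := by
  induction u generalizing g with
  | nil => rfl
  | cons y u ih => simp only [splitSum, List.cons_append, ih, add_assoc]

theorem splitSum_eq_sum_range (g : List X → List X → W) (l : List X) :
    splitSum g l = ∑ i ∈ Finset.range (l.length + 1), g (l.take i) (l.drop i) := by
  induction l generalizing g with
  | nil => simp [splitSum]
  | cons x l ih =>
    rw [splitSum, ih, List.length_cons, Finset.sum_range_succ' _ (l.length + 1), add_comm]
    simp

theorem splitSum_mem {S : Type*} [SetLike S W] [AddSubmonoidClass S W] (p : S)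
    {g : List X → List X → W} {l : List X} (H : ∀ s t, s ++ t = l → g s t ∈ p) :
    splitSum g l ∈ p := by
  induction l generalizing g with
  | nil => exact H [] [] rfl
  | cons x l ih =>
    exact add_mem (H [] (x :: l) rfl) (ih fun s t hst => H (x :: s) t (by simp [hst]))

end AddCommMonoid

variable [AddCommGroup W] [AddCommGroup W']

theorem map_units_int_smul {G : Type*} [FunLike G W W'] [AddMonoidHomClass G W W'] (φ : G)
    (c : ℤˣ) (x : W) : φ (c • x) = c • φ x := by
  rw [Units.smul_def, map_zsmul, ← Units.smul_def]

theorem smul_splitSum (c : ℤˣ) (g : List X → List X → W) (l : List X) :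
    c • splitSum g l = splitSum (fun s t => c • g s t) l :=
  map_splitSum (DistribSMul.toAddMonoidHom W c) g l

theorem splitSum_neg (g : List X → List X → W) (l : List X) :
    splitSum (fun s t => -g s t) l = -splitSum g l :=
  (map_splitSum (negAddMonoidHom : W →+ W) g l).symm

theorem splitSum_sub (g h : List X → List X → W) (l : List X) :
    splitSum (fun s t => g s t - h s t) l = splitSum g l - splitSum h l := by
  simp only [sub_eq_add_neg, splitSum_add, splitSum_neg]

/-! ### Signed shuffles of words -/

/-- The sum of `g` over the shuffles of two words. The word `v` is moved to the left through the
word `u`, and each transposition of a letter `x` of `u` with a letter `y` of `v` contributes the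
sign `β x y`. -/
def shuffleSum (β : X → X → ℤˣ) (g : List X → W) : List X → List X → W
  | [], v => g v
  | x :: u, [] => g (x :: u)
  | x :: u, y :: v => shuffleSum β (fun l => g (x :: l)) u (y :: v) +
      ((x :: u).map (β · y)).prod • shuffleSum β (fun l => g (y :: l)) (x :: u) v
termination_by u v => u.length + v.length

variable (β : X → X → ℤˣ)

@[simp] theorem shuffleSum_nil_left (g : List X → W) (v : List X) :
    shuffleSum β g [] v = g v := by rw [shuffleSum]

@[simp] theorem shuffleSum_nil_right (g : List X → W) (u : List X) :
    shuffleSum β g u [] = g u := by cases u <;> rw [shuffleSum]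

theorem shuffleSum_cons_cons (g : List X → W) (x y : X) (u v : List X) :
    shuffleSum β g (x :: u) (y :: v) = shuffleSum β (fun l => g (x :: l)) u (y :: v) +
      ((x :: u).map (β · y)).prod • shuffleSum β (fun l => g (y :: l)) (x :: u) v := by
  rw [shuffleSum]

variable {β}

theorem shuffleSum_congr {g h : List X → W} {u v : List X}
    (H : ∀ l : List X, l.length = u.length + v.length → g l = h l) :
    shuffleSum β g u v = shuffleSum β h u v := by
  induction u generalizing g h v with
  | nil => simpa using H v (by simp)
  | cons x u ihu =>
    induction v generalizing g h with
    | nil => simpa using H (x :: u) (by simp)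
    | cons y v ihv =>
      rw [shuffleSum_cons_cons, shuffleSum_cons_cons, ihu, ihv]
      · intro l hl; apply H; simp [hl] at hl ⊢; omega
      · intro l hl; apply H; simp [hl] at hl ⊢; omega

theorem map_shuffleSum {G : Type*} [FunLike G W W'] [AddMonoidHomClass G W W'] (φ : G)
    (g : List X → W) (u v : List X) :
    φ (shuffleSum β g u v) = shuffleSum β (fun l => φ (g l)) u v := by
  induction u generalizing g v with
  | nil => simp
  | cons x u ihu =>
    induction v generalizing g with
    | nil => simp
    | cons y v ihv =>
      rw [shuffleSum_cons_cons, shuffleSum_cons_cons, map_add, ihu, map_units_int_smul, ihv]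

theorem smul_shuffleSum (c : ℤˣ) (g : List X → W) (u v : List X) :
    c • shuffleSum β g u v = shuffleSum β (fun l => c • g l) u v :=
  map_shuffleSum (DistribSMul.toAddMonoidHom W c) g u v

theorem mul_shuffleSum {R : Type*} [Ring R] (a : R) (g : List X → R) (u v : List X) :
    a * shuffleSum β g u v = shuffleSum β (fun l => a * g l) u v :=
  map_shuffleSum (AddMonoidHom.mulLeft a) g u v

theorem shuffleSum_mul {R : Type*} [Ring R] (g : List X → R) (a : R) (u v : List X) :
    shuffleSum β g u v * a = shuffleSum β (fun l => g l * a) u v :=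
  map_shuffleSum (AddMonoidHom.mulRight a) g u v

theorem shuffleSum_add (g h : List X → W) (u v : List X) :
    shuffleSum β (fun l => g l + h l) u v = shuffleSum β g u v + shuffleSum β h u v := by
  induction u generalizing g h v with
  | nil => simp
  | cons x u ihu =>
    induction v generalizing g h with
    | nil => simp
    | cons y v ihv =>
      simp only [shuffleSum_cons_cons, ihu, ihv, smul_add]
      abel

theorem shuffleSum_sub (g h : List X → W) (u v : List X) :
    shuffleSum β (fun l => g l - h l) u v = shuffleSum β g u v - shuffleSum β h u v := by
  have := map_shuffleSum (β := β) (negAddMonoidHom : W →+ W) h u v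
  simp only [negAddMonoidHom_apply] at this
  simp only [sub_eq_add_neg, shuffleSum_add, ← this]

/-- The sign of moving the word `v` through the word `u`. -/
def crossSign (β : X → X → ℤˣ) (u v : List X) : ℤˣ :=
  (v.map fun y => (u.map (β · y)).prod).prod

@[simp] theorem crossSign_nil_right (u : List X) : crossSign β u [] = 1 := rfl

@[simp] theorem crossSign_nil_left (v : List X) : crossSign β [] v = 1 := by
  simp [crossSign]

/-- Deconcatenation is multiplicative for the shuffle product. -/
theorem shuffleSum_splitSum (h : List X → List X → W) (u v : List X) :
    shuffleSum β (splitSum h) u v =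
      splitSum (fun u' u'' => splitSum (fun v' v'' =>
        crossSign β u'' v' • shuffleSum β (fun s => shuffleSum β (h s) u'' v'') u' v') v) u := by
  induction u generalizing h v with
  | nil => simp [splitSum]
  | cons x u ihu =>
    induction v generalizing h with
    | nil => simp [splitSum]
    | cons y v ihv =>
      rw [shuffleSum_cons_cons]
      simp only [splitSum, shuffleSum_add, ihu, ihv]
      simp only [splitSum_add, shuffleSum_nil_left, shuffleSum_nil_right,
        crossSign_nil_right, one_smul, shuffleSum_cons_cons, smul_add, smul_splitSum, smul_smul]
      -- The sign of `y` passing `x :: u` is absorbed into the signs of the first factors.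
      have e1 : splitSum (fun v' v'' => (((x :: u).map (β · y)).prod * crossSign β (x :: u) v') •
            shuffleSum β (h (y :: v')) (x :: u) v'') v =
          splitSum (fun v' v'' => crossSign β (x :: u) (y :: v') •
            shuffleSum β (h (y :: v')) (x :: u) v'') v := rfl
      have e2 : splitSum (fun u' u'' => splitSum (fun v' v'' =>
            (((x :: u).map (β · y)).prod * crossSign β u'' v') •
              shuffleSum β (fun s => shuffleSum β (h (y :: s)) u'' v'') (x :: u') v') v) u =
          splitSum (fun u' u'' => splitSum (fun v' v'' =>
            (crossSign β u'' (y :: v') * ((x :: u').map (β · y)).prod) •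
              shuffleSum β (fun s => shuffleSum β (h (y :: s)) u'' v'') (x :: u') v') v) u := by
        refine splitSum_congr fun u' u'' hu => ?_
        subst hu
        refine splitSum_congr fun v' v'' _ => ?_
        congr 1
        simp only [crossSign, List.map_cons, List.map_append, List.prod_cons, List.prod_append]
        ac_rfl
      rw [e1, e2, one_mul]
      abel

/-- The exponent `∑ (k - 1 - j) deg (x_j)` of a word `x_0 ⋯ x_{k-1}`. It is the sign which relates
operations of degree `2 - k` and their suspensions, of degree `1`. -/
def suspExponent (deg : X → ℤ) : List X → ℤ
  | [] => 0
  | x :: l => l.length * deg x + suspExponent deg l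

theorem suspExponent_append (deg : X → ℤ) (u v : List X) :
    suspExponent deg (u ++ v) =
      suspExponent deg u + v.length * (u.map deg).sum + suspExponent deg v := by
  induction u with
  | nil => simp [suspExponent]
  | cons x u ih =>
    simp only [suspExponent, List.cons_append, ih, List.length_append, List.map_cons,
      List.sum_cons]
    push_cast; ring

theorem prod_map_negOnePow (f : X → ℤ) (l : List X) :
    (l.map fun x => (f x).negOnePow).prod = (l.map f).sum.negOnePow := by
  induction l with
  | nil => simp
  | cons x l ih => simp [ih, Int.negOnePow_add]

/-- Suspension turns the signs of shuffles into Koszul signs for the degrees lowered by one. -/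
theorem shuffleSum_suspExponent (deg : X → ℤ) (g : List X → W) (u v : List X) :
    shuffleSum (fun x y => (1 + deg x * deg y).negOnePow)
        (fun l => (suspExponent deg l).negOnePow • g l) u v =
      (suspExponent deg (u ++ v)).negOnePow •
        shuffleSum (fun x y => ((deg x - 1) * (deg y - 1)).negOnePow) g u v := by
  induction u generalizing g v with
  | nil => simp
  | cons x u ihu =>
    induction v generalizing g with
    | nil => simp
    | cons y v ihv =>
      rw [shuffleSum_cons_cons, shuffleSum_cons_cons, smul_add]
      congr 1
      · rw [shuffleSum_congr (h := fun l => ((u.length + v.length + 1 : ℤ) * deg x).negOnePow •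
          ((suspExponent deg l).negOnePow • g (x :: l))), ← smul_shuffleSum, ihu, smul_smul,
          ← Int.negOnePow_add]
        · congr 3
          simp; left; ring
        · intro l hl
          rw [smul_smul, ← Int.negOnePow_add, suspExponent, hl]
          simp [add_assoc]
      · rw [shuffleSum_congr (h := fun l => ((u.length + 1 + v.length : ℤ) * deg y).negOnePow •
          ((suspExponent deg l).negOnePow • g (y :: l))), ← smul_shuffleSum, ihv, smul_smul,
          smul_smul, smul_smul, prod_map_negOnePow, prod_map_negOnePow, ← Int.negOnePow_add,
          ← Int.negOnePow_add, ← Int.negOnePow_add]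
        · congr 1
          rw [Int.negOnePow_eq_iff]
          simp only [suspExponent_append, suspExponent]
          have h1 : ((x :: u).map fun z => 1 + deg z * deg y).sum =
              (u.length + 1) + ((x :: u).map deg).sum * deg y := by
            generalize hz : x :: u = z
            rw [show (u.length + 1 : ℤ) = z.length by rw [← hz]; simp]
            clear hz
            induction z with
            | nil => simp
            | cons a z ih =>
              simp only [List.map_cons, List.sum_cons, List.length_cons, ih]
              push_cast
              ring
          have h2 : ((x :: u).map fun z => (deg z - 1) * (deg y - 1)).sum =
              (((x :: u).map deg).sum - (u.length + 1)) * (deg y - 1) := by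
            generalize hz : x :: u = z
            rw [show (u.length + 1 : ℤ) = z.length by rw [← hz]; simp]
            clear hz
            induction z with
            | nil => simp
            | cons a z ih =>
              simp only [List.map_cons, List.sum_cons, List.length_cons, ih]
              push_cast
              ring
          rw [h1, h2]
          generalize ((x :: u).map deg).sum = S
          simp only [List.length_cons]
          push_cast
          exact ⟨u.length * deg y + deg y, by ring⟩
        · intro l hl
          rw [smul_smul, ← Int.negOnePow_add, suspExponent, hl]
          simp

end Deconcatenation

/-! ### Slot-linear functions of words -/

section SlotLinear

variable (K : Type*) [Field K] {V W : Type*} [AddCommGroup V] [Module K V]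
  [AddCommGroup W] [Module K W]

/-- A function of words is slot-linear if it is linear in each letter. -/
structure IsSlotLinear (g : List V → W) : Prop where
  add : ∀ u x y w, g (u ++ (x + y) :: w) = g (u ++ x :: w) + g (u ++ y :: w)
  smul : ∀ u (c : K) x w, g (u ++ (c • x) :: w) = c • g (u ++ x :: w)

variable {K}

theorem IsSlotLinear.zero {g : List V → W} (hg : IsSlotLinear K g) (u w : List V) :
    g (u ++ 0 :: w) = 0 := by
  simpa using hg.smul u 0 0 w

theorem IsSlotLinear.comp {W' : Type*} [AddCommGroup W'] [Module K W'] {g : List V → W}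
    (hg : IsSlotLinear K g) (φ : W →ₗ[K] W') : IsSlotLinear K fun l => φ (g l) where
  add u x y w := by rw [hg.add, map_add]
  smul u c x w := by rw [hg.smul, map_smul]

theorem IsSlotLinear.sub {g g' : List V → W} (hg : IsSlotLinear K g) (hg' : IsSlotLinear K g') :
    IsSlotLinear K fun l => g l - g' l where
  add u x y w := by rw [hg.add, hg'.add]; abel
  smul u c x w := by rw [hg.smul, hg'.smul, smul_sub]

end SlotLinear

namespace PoincareDGCA

namespace HodgeHomotopy

variable {K : Type u} [Field K] {n : ℕ} {A : PoincareDGCA.{u, v} K n} (h : A.HodgeHomotopy)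

/-! ### The transferred operations on words -/

/-- The inclusion `H → A`, extended by zero to the words of length different from `1`. -/
def letter : List h.harmonic → A.carrier
  | [x] => x
  | _ => 0

variable (A) in
/-- The cup square of a function `g` of degree `1` (for the suspended degrees of the letters):
`l ↦ ∑ (-1)^{deg g(s)} g(s) g(t)` over the deconcatenations `l = s ++ t`. -/
noncomputable def cupSq {X : Type*} (g : List X → A.carrier) (l : List X) : A.carrier :=
  splitSum (fun s t => A.parity (g s) * g t) l

/-- Approximations of the fixed point of `F = letter - δ ∘ cupSq F`. -/
noncomputable def approx : ℕ → List h.harmonic → A.carrier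
  | 0 => h.letter
  | m + 1 => fun l => h.letter l - h.δ (cupSq A (approx m) l)

theorem approx_succ_apply (m : ℕ) (l : List h.harmonic) :
    h.approx (m + 1) l = h.letter l - h.δ (cupSq A (h.approx m) l) := rfl

/-- The twisting function `F`, a Maurer-Cartan element: up to suspension signs its component of
arity `k` is the component `f_k` of the transferred `C∞`-morphism `H → A`. It is the fixed point of
`F = letter - δ ∘ cupSq F`. -/
noncomputable def twisting (l : List h.harmonic) : A.carrier := h.approx l.length l

/-- The transferred operations: up to suspension signs, `m_k` is the component of arity `k`. -/
noncomputable def transferred (l : List h.harmonic) : h.harmonic :=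
  h.toHarmonic (cupSq A h.twisting l)

@[simp] theorem letter_nil : h.letter [] = 0 := rfl

@[simp] theorem letter_singleton (x : h.harmonic) : h.letter [x] = x := rfl

@[simp] theorem letter_cons_cons (x y : h.harmonic) (l : List h.harmonic) :
    h.letter (x :: y :: l) = 0 := rfl

theorem letter_eq_zero {l : List h.harmonic} (hl : 2 ≤ l.length) : h.letter l = 0 := by
  match l with
  | [] => rfl
  | [x] => simp at hl
  | x :: y :: l => rfl

theorem δ_letter (l : List h.harmonic) : h.δ (h.letter l) = 0 := by
  match l with
  | [] => simp
  | [x] => simp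
  | x :: y :: l => simp

theorem d_letter (l : List h.harmonic) : A.d (h.letter l) = 0 := by
  match l with
  | [] => simp
  | [x] => simp
  | x :: y :: l => simp

theorem cupSq_congr {X : Type*} {g g' : List X → A.carrier} {l : List X} (h0 : g [] = 0)
    (h0' : g' [] = 0) (H : ∀ s, s.length < l.length → g s = g' s) :
    cupSq A g l = cupSq A g' l := by
  refine splitSum_congr fun s t hst => ?_
  rcases s with _ | ⟨x, s⟩
  · simp [h0, h0']
  rcases t with _ | ⟨y, t⟩
  · simp [h0, h0']
  have hl := congrArg List.length hst
  simp only [List.length_append, List.length_cons] at hl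
  rw [H _ (by simp; omega), H _ (by simp; omega)]

@[simp] theorem approx_nil (m : ℕ) : h.approx m [] = 0 := by
  induction m with
  | zero => rfl
  | succ m ih => simp [approx, cupSq, splitSum, ih]

@[simp] theorem approx_singleton (m : ℕ) (x : h.harmonic) : h.approx m [x] = x := by
  cases m with
  | zero => rfl
  | succ m => simp [approx, cupSq, splitSum]

/-- On words of length at most `m` the approximations are stable from the index `m` on. -/
theorem approx_succ {m : ℕ} {l : List h.harmonic} (hl : l.length ≤ m) :
    h.approx (m + 1) l = h.approx m l := by
  induction m generalizing l with
  | zero =>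
    rw [List.length_eq_zero_iff.1 (Nat.le_zero.1 hl)]; simp
  | succ m ih =>
    rw [approx_succ_apply, approx_succ_apply, cupSq_congr (h.approx_nil _) (h.approx_nil _)
      fun s hs => ih (by omega)]

theorem approx_eq_twisting {m : ℕ} {l : List h.harmonic} (hl : l.length ≤ m) :
    h.approx m l = h.twisting l := by
  induction m, hl using Nat.le_induction with
  | base => rfl
  | succ m hm ih => rw [approx_succ _ hm, ih]

@[simp] theorem twisting_nil : h.twisting [] = 0 := h.approx_nil _

@[simp] theorem twisting_singleton (x : h.harmonic) : h.twisting [x] = x := h.approx_singleton _ x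

theorem twisting_eq (l : List h.harmonic) :
    h.twisting l = h.letter l - h.δ (cupSq A h.twisting l) := by
  rw [← h.approx_eq_twisting (Nat.le_succ l.length), approx_succ_apply,
    cupSq_congr (h.approx_nil _) h.twisting_nil fun s hs => h.approx_eq_twisting hs.le]

theorem coe_transferred (l : List h.harmonic) :
    (h.transferred l : A.carrier) = h.proj (cupSq A h.twisting l) := rfl

@[simp] theorem transferred_nil : h.transferred [] = 0 := by
  simp [transferred, cupSq, splitSum]

@[simp] theorem transferred_singleton (x : h.harmonic) : h.transferred [x] = 0 := by
  simp [transferred, cupSq, splitSum]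

/-! ### Linearity, degrees, the unit -/

theorem isSlotLinear_letter : IsSlotLinear K h.letter where
  add u x y w := by
    match u, w with
    | [], [] => rfl
    | [], _ :: _ => simp
    | [_], _ => simp
    | _ :: _ :: _, _ => simp
  smul u c x w := by
    match u, w with
    | [], [] => rfl
    | [], _ :: _ => simp
    | [_], _ => simp
    | _ :: _ :: _, _ => simp

theorem isSlotLinear_cupSq {V : Type*} [AddCommGroup V] [Module K V] {g : List V → A.carrier}
    (hg : IsSlotLinear K g) : IsSlotLinear K (cupSq A g) where
  add u x y w := by
    simp only [cupSq, splitSum_append_cons, hg.add, mul_add, map_add, add_mul, splitSum_add]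
    abel
  smul u c x w := by
    simp only [cupSq, splitSum_append_cons, hg.smul, map_smul, smul_mul_assoc, mul_smul_comm]
    rw [smul_add]
    congr 1
    · exact (map_splitSum (DistribSMul.toAddMonoidHom A.carrier c) _ _).symm
    · exact (map_splitSum (DistribSMul.toAddMonoidHom A.carrier c) _ _).symm

theorem isSlotLinear_approx (m : ℕ) : IsSlotLinear K (h.approx m) := by
  induction m with
  | zero => exact h.isSlotLinear_letter
  | succ m ih => exact h.isSlotLinear_letter.sub ((isSlotLinear_cupSq ih).comp h.δ)

theorem isSlotLinear_twisting : IsSlotLinear K h.twisting where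
  add u x y w := by
    simpa [twisting] using (h.isSlotLinear_approx _).add u x y w
  smul u c x w := by
    simpa [twisting] using (h.isSlotLinear_approx _).smul u c x w

theorem isSlotLinear_transferred : IsSlotLinear K h.transferred :=
  (isSlotLinear_cupSq h.isSlotLinear_twisting).comp h.toHarmonic

theorem δ_twisting (l : List h.harmonic) : h.δ (h.twisting l) = 0 := by
  rw [twisting_eq, map_sub, δ_letter, h.δ_δ, sub_zero]

theorem twisting_eq_δ {l : List h.harmonic} (hl : 2 ≤ l.length) :
    h.twisting l = h.δ (-cupSq A h.twisting l) := by
  rw [twisting_eq, h.letter_eq_zero hl, zero_sub, map_neg]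

section Degree

variable {h} {X : Type*} {val : X → h.harmonic} {deg : X → ℤ}

theorem letter_mem (hval : ∀ x, val x ∈ h.harmonicGr (deg x)) (l : List X) :
    h.letter (l.map val) ∈ A.gr ((l.map deg).sum + 1 - l.length) := by
  match l with
  | [] => simp
  | [x] => simpa using (show (val x : A.carrier) ∈ A.gr (deg x) from hval x)
  | _ :: _ :: _ => simp

theorem cupSq_mem {g : List X → A.carrier}
    (hg : ∀ l, g l ∈ A.gr ((l.map deg).sum + 1 - l.length)) (l : List X) :
    cupSq A g l ∈ A.gr ((l.map deg).sum + 2 - l.length) := by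
  refine splitSum_mem _ fun s t hst => ?_
  subst hst
  have := SetLike.GradedMul.mul_mem (DGCA.parity_mem (hg s)) (hg t)
  convert this using 2
  simp; ring

theorem cupSq_map {Y : Type*} (g : List Y → A.carrier) (f : X → Y) (l : List X) :
    cupSq A g (l.map f) = cupSq A (fun l => g (l.map f)) l := splitSum_map _ _ _

theorem approx_mem (hval : ∀ x, val x ∈ h.harmonicGr (deg x)) (m : ℕ) (l : List X) :
    h.approx m (l.map val) ∈ A.gr ((l.map deg).sum + 1 - l.length) := by
  induction m generalizing l with
  | zero => exact letter_mem hval l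
  | succ m ih =>
    refine sub_mem (letter_mem hval l) ?_
    rw [cupSq_map]
    convert h.δ_mem _ _ (cupSq_mem ih l) using 2
    ring

theorem twisting_mem (hval : ∀ x, val x ∈ h.harmonicGr (deg x)) (l : List X) :
    h.twisting (l.map val) ∈ A.gr ((l.map deg).sum + 1 - l.length) :=
  approx_mem hval _ l

theorem transferred_mem (hval : ∀ x, val x ∈ h.harmonicGr (deg x)) (l : List X) :
    h.transferred (l.map val) ∈ h.harmonicGr ((l.map deg).sum + 2 - l.length) := by
  refine h.proj_mem ?_
  rw [cupSq_map]
  exact cupSq_mem (twisting_mem hval) l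

end Degree

theorem δ_cup_eq_zero_of_one_mem {s t : List h.harmonic} (hl : h.harmonicOne ∈ s ++ t)
    (H : ∀ l, h.harmonicOne ∈ l → 2 ≤ l.length → l.length < (s ++ t).length → h.twisting l = 0) :
    h.δ (A.parity (h.twisting s) * h.twisting t) = 0 ∧ (3 ≤ (s ++ t).length →
      h.proj (A.parity (h.twisting s) * h.twisting t) = 0) := by
  rcases eq_or_ne s [] with rfl | hs0
  · simp
  rcases eq_or_ne t [] with rfl | ht0
  · simp
  have hs1 := List.length_pos_iff.2 hs0
  have ht1 := List.length_pos_iff.2 ht0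
  have e1 : (h.harmonicOne : A.carrier) = 1 := rfl
  rw [List.length_append]
  rcases List.mem_append.1 hl with hs | ht
  · by_cases hs2 : 2 ≤ s.length
    · rw [H s hs hs2 (by simp; omega)]; simp
    · obtain ⟨x, rfl⟩ := List.length_eq_one_iff.1 (show s.length = 1 by omega)
      obtain rfl := List.mem_singleton.1 hs
      rw [twisting_singleton, e1, DGCA.parity_one, one_mul]
      refine ⟨h.δ_twisting t, fun h3 => ?_⟩
      rw [h.twisting_eq_δ (by simp at h3; omega), proj_δ]
  · by_cases ht2 : 2 ≤ t.length
    · rw [H t ht ht2 (by simp; omega)]; simp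
    · obtain ⟨x, rfl⟩ := List.length_eq_one_iff.1 (show t.length = 1 by omega)
      obtain rfl := List.mem_singleton.1 ht
      rw [twisting_singleton, e1, mul_one]
      refine ⟨?_, fun h3 => ?_⟩
      · rw [← neg_eq_zero, ← parity_δ, δ_twisting, map_zero]
      · rw [← parity_proj, h.twisting_eq_δ (by simp at h3; omega), proj_δ, map_zero]

/-- The vanishing on the unit follows from the side conditions `δ δ = 0` and `δ π_H = 0`. -/
theorem twisting_eq_zero_of_one_mem {l : List h.harmonic} (hl : h.harmonicOne ∈ l)
    (h2 : 2 ≤ l.length) : h.twisting l = 0 := by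
  induction hk : l.length using Nat.strong_induction_on generalizing l with
  | _ k ih =>
    subst hk
    rw [h.twisting_eq, h.letter_eq_zero h2, cupSq, map_splitSum, splitSum_eq_zero, sub_zero]
    rintro s t rfl
    exact (h.δ_cup_eq_zero_of_one_mem hl fun l' h1 h2 h3 => ih _ h3 h1 h2 rfl).1

theorem transferred_eq_zero_of_one_mem {l : List h.harmonic} (hl : h.harmonicOne ∈ l)
    (h3 : 3 ≤ l.length) : h.transferred l = 0 := by
  ext
  rw [coe_transferred, cupSq, map_splitSum, splitSum_eq_zero]; · rfl
  rintro s t rfl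
  exact (h.δ_cup_eq_zero_of_one_mem hl fun l' h1 h2 _ =>
    h.twisting_eq_zero_of_one_mem h1 h2).2 h3

/-! ### The Maurer-Cartan equation -/

/-- The suspended degree involution of the letters. -/
noncomputable def suspParity : h.harmonic →ₗ[K] h.harmonic := -h.harmonicParity

theorem letter_map_suspParity (l : List h.harmonic) :
    h.letter (l.map h.suspParity) = -A.parity (h.letter l) := by
  match l with
  | [] => simp
  | [x] => simp [suspParity]
  | _ :: _ :: _ => simp

theorem twisting_map_suspParity (l : List h.harmonic) :
    h.twisting (l.map h.suspParity) = -A.parity (h.twisting l) := by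
  have key : ∀ m l, h.approx m (l.map h.suspParity) = -A.parity (h.approx m l) := by
    intro m
    induction m with
    | zero => exact h.letter_map_suspParity
    | succ m ih =>
      intro l
      have e : cupSq A (h.approx m) (l.map h.suspParity) = A.parity (cupSq A (h.approx m) l) := by
        rw [cupSq_map, cupSq, cupSq, map_splitSum]
        simp only [ih, DGCA.parity_mul, map_neg, neg_mul_neg]
      rw [approx_succ_apply, approx_succ_apply, e, letter_map_suspParity, map_sub, parity_δ]
      abel
  rw [twisting, key, List.length_map]; rfl

/-- The composite of a function `g` of words with the coderivation of the tensor coalgebra whose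
corestriction is given by the transferred operations: the sum of the values of `g` on the words
in which a subword `v` of `l = u ++ v ++ w` is replaced by the letter `transferred v`, with the
Koszul sign of moving past `u`. The empty subword does not contribute if `g` is slot-linear, since
`transferred [] = 0`. -/
noncomputable def insertSum {W : Type*} [AddCommGroup W] (g : List h.harmonic → W)
    (l : List h.harmonic) : W :=
  splitSum (fun u r => splitSum (fun v w => g (u.map h.suspParity ++ h.transferred v :: w)) r) l

theorem map_insertSum {W W' G : Type*} [AddCommGroup W] [AddCommGroup W'] [FunLike G W W']
    [AddMonoidHomClass G W W'] (φ : G) (g : List h.harmonic → W) (l : List h.harmonic) :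
    φ (h.insertSum g l) = h.insertSum (fun l => φ (g l)) l := by
  simp only [insertSum, map_splitSum]

theorem insertSum_letter (l : List h.harmonic) :
    h.insertSum h.letter l = h.transferred l := by
  rw [insertSum, splitSum_eq_left_nil, splitSum_eq_right_nil]
  · simp
  · simp
  · intro x s t
    refine splitSum_eq_zero fun v w _ => h.letter_eq_zero ?_
    simp only [List.map_cons, List.cons_append, List.length_cons, List.length_append]
    omega

/-- The coderivation acts on cup products as a derivation. -/
theorem insertSum_cupSq (l : List h.harmonic) :
    h.insertSum (cupSq A h.twisting) l = splitSum (fun s t =>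
      A.parity (h.insertSum h.twisting s) * h.twisting t -
        h.twisting s * h.insertSum h.twisting t) l := by
  simp only [insertSum, cupSq, splitSum_append_cons, splitSum_map, splitSum_add, splitSum_sub,
    twisting_map_suspParity, map_neg, DGCA.parity_parity]
  rw [add_comm, sub_eq_add_neg]
  congr 1
  · have e : ∀ u r : List h.harmonic, splitSum (fun v w => splitSum (fun s t => A.parity (h.twisting
        (u.map h.suspParity ++ h.transferred v :: s)) * h.twisting t) w) r =
        splitSum (fun q t => splitSum (fun v s => A.parity (h.twisting
        (u.map h.suspParity ++ h.transferred v :: s)) * h.twisting t) q) r := fun u r =>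
      splitSum_assoc (fun v s t => A.parity (h.twisting
        (u.map h.suspParity ++ h.transferred v :: s)) * h.twisting t) r
    simp only [map_splitSum, splitSum_mul]
    refine (splitSum_congr fun u r _ => e u r).trans ?_
    exact splitSum_assoc (fun u q t => splitSum (fun v s => A.parity (h.twisting
        (u.map h.suspParity ++ h.transferred v :: s)) * h.twisting t) q) l
  · rw [← splitSum_neg]
    simp only [mul_splitSum, ← splitSum_neg, ← neg_mul]
    refine Eq.trans ?_ (splitSum_assoc (fun s t r => splitSum (fun v w => -h.twisting s *
      h.twisting (t.map h.suspParity ++ h.transferred v :: w)) r) l).symm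
    exact splitSum_congr fun u r _ => splitSum_comm (fun v w s t => -h.twisting s *
      h.twisting (t.map h.suspParity ++ h.transferred v :: w)) r u

theorem d_cupSq (l : List h.harmonic) :
    A.d (cupSq A h.twisting l) = splitSum (fun s t =>
      h.twisting s * A.d (h.twisting t) - A.parity (A.d (h.twisting s)) * h.twisting t) l := by
  rw [cupSq, map_splitSum]
  refine splitSum_congr fun s t _ => ?_
  rw [DGCA.d_mul, DGCA.parity_parity, DGCA.parity_d]
  noncomm_ring

/-- Associativity of the convolution product: `cupSq F` commutes with `F`. -/
theorem cupSq_comm (l : List h.harmonic) :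
    splitSum (fun s t => A.parity (cupSq A h.twisting s) * h.twisting t) l =
      splitSum (fun s t => h.twisting s * cupSq A h.twisting t) l := by
  simp only [cupSq, map_splitSum, DGCA.parity_mul, DGCA.parity_parity]
  simp only [mul_splitSum, splitSum_mul, mul_assoc]
  exact (splitSum_assoc (fun a b c => h.twisting a * (A.parity (h.twisting b) * h.twisting c))
    l).symm

/-- The failure of the Maurer-Cartan equation. -/
noncomputable def defect (l : List h.harmonic) : A.carrier :=
  h.insertSum h.twisting l - A.d (h.twisting l) - cupSq A h.twisting l

theorem insertSum_cupSq_add_d (l : List h.harmonic) :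
    h.insertSum (cupSq A h.twisting) l + A.d (cupSq A h.twisting l) = splitSum (fun s t =>
      A.parity (h.defect s) * h.twisting t - h.twisting s * h.defect t) l := by
  rw [insertSum_cupSq, d_cupSq, ← splitSum_add, ← sub_eq_zero, ← splitSum_sub]
  have := h.cupSq_comm l
  rw [← sub_eq_zero, ← splitSum_sub] at this
  rw [← this]
  refine splitSum_congr fun s t _ => ?_
  simp only [defect, map_sub]
  noncomm_ring

theorem defect_eq (l : List h.harmonic) :
    h.defect l = -h.δ (h.insertSum (cupSq A h.twisting) l + A.d (cupSq A h.twisting l)) := by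
  have h1 : h.insertSum h.twisting l =
      h.transferred l - h.δ (h.insertSum (cupSq A h.twisting) l) := by
    rw [map_insertSum, ← insertSum_letter, insertSum, insertSum, insertSum, ← splitSum_sub]
    refine splitSum_congr fun u r _ => ?_
    rw [← splitSum_sub]
    exact splitSum_congr fun v w _ => h.twisting_eq _
  rw [defect, h1, h.twisting_eq, map_sub, d_letter, coe_transferred, proj_apply, map_add]
  abel

theorem defect_eq_zero (l : List h.harmonic) : h.defect l = 0 := by
  induction hk : l.length using Nat.strong_induction_on generalizing l with
  | _ k ih =>
    subst hk
    rw [defect_eq, insertSum_cupSq_add_d, splitSum_eq_zero, map_zero, neg_zero]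
    rintro s t rfl
    -- Both factors are nonempty or the term is zero, hence both are shorter than the word.
    rcases eq_or_ne s [] with rfl | hs
    · have : h.defect [] = 0 := by
        simp [defect, insertSum, splitSum, cupSq]
      simp [this]
    rcases eq_or_ne t [] with rfl | ht
    · have : h.defect [] = 0 := by
        simp [defect, insertSum, splitSum, cupSq]
      simp [this]
    have hs1 := List.length_pos_iff.2 hs
    have ht1 := List.length_pos_iff.2 ht
    rw [ih _ (by simp; omega) s rfl, ih _ (by simp; omega) t rfl]
    simp

/-- The Maurer-Cartan equation: `twisting` is a morphism from the transferred structure to `A`. -/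
theorem insertSum_twisting (l : List h.harmonic) :
    h.insertSum h.twisting l = A.d (h.twisting l) + cupSq A h.twisting l := by
  have := h.defect_eq_zero l
  rw [defect, sub_sub, sub_eq_zero] at this
  exact this

/-- The coderivation of the transferred operations squares to zero. -/
theorem insertSum_transferred (l : List h.harmonic) : h.insertSum h.transferred l = 0 := by
  have h1 := h.insertSum_cupSq_add_d l
  rw [splitSum_eq_zero fun s t _ => by simp [defect_eq_zero]] at h1
  have h2 : h.insertSum h.transferred l = h.toHarmonic (h.insertSum (cupSq A h.twisting) l) :=
    (h.map_insertSum h.toHarmonic _ l).symm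
  rw [h2, eq_neg_of_add_eq_zero_left h1]
  ext
  simp [proj_d]

/-! ### Shuffles -/

section Shuffle

variable {h} {X : Type*} {val : X → h.harmonic} {deg : X → ℤ}

theorem crossSign_suspDegree (u v : List X) :
    crossSign (fun x y => ((deg x - 1) * (deg y - 1)).negOnePow) u v =
      (((u.map deg).sum - u.length) * ((v.map deg).sum - v.length)).negOnePow := by
  have e1 : ∀ (u : List X) (c : ℤ),
      (u.map fun x => (deg x - 1) * c).sum = ((u.map deg).sum - u.length) * c := by
    intro u c
    induction u with
    | nil => simp
    | cons x u ih =>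
      simp only [List.map_cons, List.sum_cons, ih, List.length_cons]; push_cast; ring
  simp only [crossSign, prod_map_negOnePow, e1]
  congr 1
  simp only [mul_comm ((u.map deg).sum - (u.length : ℤ)), e1 v]

/-- Cup squares of functions that vanish on shuffles vanish on shuffles, because the product of `A`
is graded commutative. -/
theorem shuffleSum_cupSq {g : List X → A.carrier}
    (hg : ∀ l, g l ∈ A.gr ((l.map deg).sum + 1 - l.length))
    (hsh : ∀ x u y v,
      shuffleSum (fun x y => ((deg x - 1) * (deg y - 1)).negOnePow) g (x :: u) (y :: v) = 0)
    (x : X) (u : List X) (y : X) (v : List X) :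
    shuffleSum (fun x y => ((deg x - 1) * (deg y - 1)).negOnePow) (cupSq A g)
      (x :: u) (y :: v) = 0 := by
  set β : X → X → ℤˣ := fun x y => ((deg x - 1) * (deg y - 1)).negOnePow with hβ
  have e : cupSq A g = splitSum (fun s t => A.parity (g s) * g t) := rfl
  have e2 : ∀ u' v' u'' v'', shuffleSum β (fun s => shuffleSum β
      (fun t => A.parity (g s) * g t) u'' v'') u' v' =
        A.parity (shuffleSum β g u' v') * shuffleSum β g u'' v'' := by
    intro u' v' u'' v''
    simp only [← mul_shuffleSum]
    rw [← shuffleSum_mul, map_shuffleSum]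
  rw [e, shuffleSum_splitSum]
  simp only [e2]
  -- The only deconcatenations that contribute are those with `u'` and `v''` empty, or `u''` and
  -- `v'` empty.
  rw [splitSum, splitSum_eq_right_nil, splitSum_eq_right_nil, splitSum_eq_left_nil]
  · simp only [shuffleSum_nil_left, shuffleSum_nil_right, crossSign_nil_left, one_smul]
    rw [hβ, crossSign_suspDegree, DGCA.parity_of_mem (hg _), DGCA.parity_of_mem (hg _),
      smul_mul_assoc, smul_mul_assoc, A.mul_comm_gr _ _ _ _ (hg (x :: u)) (hg (y :: v)),
      smul_smul, smul_smul, ← Int.negOnePow_add, ← Int.negOnePow_add]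
    generalize ((x :: u).map deg).sum = a
    generalize ((y :: v).map deg).sum = b
    generalize ((x :: u).length : ℤ) = c
    generalize ((y :: v).length : ℤ) = d
    rw [show (a + 1 - c + (a + 1 - c) * (b + 1 - d)) =
      ((a - c) * (b - d) + (b + 1 - d)) + (2 * (a - c) + 1) by ring, Int.negOnePow_add _ (_ + 1),
      Int.negOnePow_two_mul_add_one]
    simp
  · intro y' s t
    rw [hsh]; simp
  · intro s z t
    refine splitSum_eq_zero fun v' v'' hv => ?_
    rcases v' with _ | ⟨y', v'⟩
    · rw [List.nil_append] at hv
      rw [hv, hsh]; simp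
    · rw [hsh]; simp
  · intro s z t
    rw [hsh]; simp

theorem shuffleSum_letter (β : X → X → ℤˣ) (x : X) (u : List X) (y : X) (v : List X) :
    shuffleSum β (fun l => h.letter (l.map val)) (x :: u) (y :: v) = 0 := by
  rw [shuffleSum_congr (h := fun _ => (0 : A.carrier))]
  · exact (map_shuffleSum (0 : A.carrier →+ A.carrier) (fun _ => 0) _ _).symm
  · intro l hl
    exact h.letter_eq_zero (by simp at hl ⊢; omega)

theorem shuffleSum_twisting (hval : ∀ x, val x ∈ h.harmonicGr (deg x))
    (x : X) (u : List X) (y : X) (v : List X) :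
    shuffleSum (fun x y => ((deg x - 1) * (deg y - 1)).negOnePow)
      (fun l => h.twisting (l.map val)) (x :: u) (y :: v) = 0 := by
  have key : ∀ m x u y v, shuffleSum (fun x y => ((deg x - 1) * (deg y - 1)).negOnePow)
      (fun l => h.approx m (l.map val)) (x :: u) (y :: v) = 0 := by
    intro m
    induction m with
    | zero => exact shuffleSum_letter _
    | succ m ih =>
      intro x u y v
      have := shuffleSum_cupSq (approx_mem hval m) ih x u y v
      simp only [approx_succ_apply, cupSq_map]
      rw [shuffleSum_sub, shuffleSum_letter, ← map_shuffleSum h.δ, this, map_zero, sub_zero]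
  rw [← key ((x :: u).length + (y :: v).length) x u y v]
  exact shuffleSum_congr fun l hl => (h.approx_eq_twisting (by simp [hl])).symm

theorem shuffleSum_transferred (hval : ∀ x, val x ∈ h.harmonicGr (deg x))
    (x : X) (u : List X) (y : X) (v : List X) :
    shuffleSum (fun x y => ((deg x - 1) * (deg y - 1)).negOnePow)
      (fun l => h.transferred (l.map val)) (x :: u) (y :: v) = 0 := by
  simp only [transferred, cupSq_map]
  rw [← map_shuffleSum h.toHarmonic]
  have := shuffleSum_cupSq (twisting_mem hval) (shuffleSum_twisting hval) x u y v
  rw [this, map_zero]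

end Shuffle

/-! ### Vanishing for degree reasons -/

section Vanishing

variable {h} {X : Type*} {val : X → h.harmonic} {deg : X → ℤ}

theorem pairing_twisting (hval : ∀ x, val x ∈ h.harmonicGr (deg x)) {s t : List X}
    (h3 : 3 ≤ (s ++ t).length) :
    A.pairing (A.parity (h.twisting (s.map val))) (h.twisting (t.map val)) = 0 := by
  have hp : ∀ s : List X, 2 ≤ s.length →
      ∃ c, A.parity (h.twisting (s.map val)) = h.δ c := fun s hs =>
    ⟨_, by rw [h.twisting_eq_δ (by simpa using hs), parity_δ, ← map_neg]⟩
  have h0 : ∀ a, A.pairing 0 a = 0 := fun a => by simp [pairing]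
  have h0' : ∀ a, A.pairing a 0 = 0 := fun a => by simp [pairing]
  rw [List.length_append] at h3
  by_cases ht : 2 ≤ t.length
  · rw [h.twisting_eq_δ (l := t.map val) (by simpa using ht)]
    match s with
    | [] => simp [h0]
    | [x] =>
      rw [List.map_singleton, twisting_singleton, ← coe_harmonicParity, pairing_coe_δ]
    | x :: y :: s =>
      obtain ⟨c, hc⟩ := hp (x :: y :: s) (by simp)
      rw [hc, h.pairing_δ_δ]
  · match t with
    | [] => simp [h0']
    | [x] =>
      obtain ⟨c, hc⟩ := hp s (by simp at h3; omega)
      rw [hc, List.map_singleton, twisting_singleton]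
      refine h.pairing_δ_coe (hval x) (j := (s.map deg).sum + 1 - s.length) ?_
      rw [← hc]
      exact DGCA.parity_mem (twisting_mem hval s)
    | x :: y :: t => simp at ht

/-- In top degree the transferred operations of arity at least `3` vanish, since `Im δ` is
isotropic and orthogonal to the harmonic subspace. -/
theorem transferred_eq_zero_of_top {r : ℕ} (hA : A.IsConnected r)
    (hval : ∀ x, val x ∈ h.harmonicGr (deg x)) {l : List X} (h3 : 3 ≤ l.length)
    (hn : (l.map deg).sum + 2 - l.length = n) : h.transferred (l.map val) = 0 := by
  have h1 := transferred_mem hval l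
  have h2 : cupSq A h.twisting (l.map val) ∈ A.gr n := by
    rw [cupSq_map, ← hn]
    exact cupSq_mem (twisting_mem hval) l
  rw [hn] at h1
  refine h.eq_zero_of_integral_eq_zero hA h1 ?_
  rw [coe_transferred, integral_proj _ h2, cupSq_map, cupSq]
  simp only [map_splitSum]
  refine splitSum_eq_zero fun s t hst => ?_
  subst hst
  exact pairing_twisting hval h3

/-- The transferred operations of arity at least `3` vanish for degree reasons: arguments of degree
less than `r` are multiples of the unit, and the degree of the value is at least `n - r + 1`. -/
theorem transferred_eq_zero {r : ℕ} (hr : 2 ≤ r) (hA : A.IsConnected (r - 1))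
    (hval : ∀ x, val x ∈ h.harmonicGr (deg x)) {l : List X} (h3 : 3 ≤ l.length)
    (hn : n ≤ (l.length + 1) * (r - 1) + 2) : h.transferred (l.map val) = 0 := by
  by_cases h0 : ∃ x ∈ l, val x = 0
  · obtain ⟨x, hx, h0⟩ := h0
    obtain ⟨s, t, rfl⟩ := List.append_of_mem hx
    rw [List.map_append, List.map_cons, h0, h.isSlotLinear_transferred.zero]
  by_cases h1 : ∃ x ∈ l, deg x = 0
  · obtain ⟨x, hx, h1⟩ := h1
    have := hval x
    rw [h1] at this
    obtain ⟨c, hc⟩ := h.exists_eq_smul_one hA this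
    obtain ⟨s, t, rfl⟩ := List.append_of_mem hx
    rw [List.map_append, List.map_cons, hc, h.isSlotLinear_transferred.smul,
      h.transferred_eq_zero_of_one_mem (by simp) (by simpa using h3), smul_zero]
  push Not at h0 h1
  have hdeg : ∀ x ∈ l, (r : ℤ) ≤ deg x := by
    intro x hx
    by_contra hlt
    push Not at hlt
    refine h0 x hx ?_
    rcases lt_trichotomy (deg x) 0 with hneg | hz | hpos
    · have := hval x
      rw [harmonicGr, A.gr_neg _ hneg] at this
      exact Subtype.ext ((Submodule.mem_bot K).1 this)
    · exact absurd hz (h1 x hx)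
    · refine h.harmonic_eq_zero ?_ (hval x)
      have := hA.pos (deg x).toNat (by omega) (by omega)
      rwa [Int.toNat_of_nonneg hpos.le] at this
  have hsum : (l.length : ℤ) * r ≤ (l.map deg).sum := by
    have := List.card_nsmul_le_sum (l.map deg) (r : ℤ) (by simpa using hdeg)
    simpa using this
  have hmem := transferred_mem hval l
  have hn' : (n : ℤ) ≤ (l.length + 1) * (r - 1) + 2 := by
    have : ((r - 1 : ℕ) : ℤ) = r - 1 := by omega
    rw [← this]; exact_mod_cast hn
  rcases lt_trichotomy ((l.map deg).sum + 2 - l.length) (n : ℤ) with hlt | heq | hgt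
  · refine h.harmonic_eq_zero (cohGr_eq_bot hA ?_ hlt) hmem
    have : ((r - 1 : ℕ) : ℤ) = r - 1 := by omega
    rw [this]
    linarith
  · exact transferred_eq_zero_of_top hA hval h3 heq
  · rw [harmonicGr, A.gr_above _ hgt] at hmem
    exact Subtype.ext ((Submodule.mem_bot K).1 hmem)

end Vanishing

end HodgeHomotopy

end PoincareDGCA

/-! ### Shuffle permutations and shuffles of words -/

section ShufflePermutations

/-- The permutation of `Fin (N + 1)` which moves `z` to the first position and otherwise acts as
`τ`. -/
def insertFirst {N : ℕ} (z : Fin (N + 1)) (τ : Equiv.Perm (Fin N)) : Equiv.Perm (Fin (N + 1)) :=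
  (finSuccEquiv' z).trans ((Equiv.optionCongr τ).trans (finSuccEquiv' 0).symm)

variable {N : ℕ}

@[simp] theorem insertFirst_self (z : Fin (N + 1)) (τ : Equiv.Perm (Fin N)) :
    insertFirst z τ z = 0 := by simp [insertFirst]

@[simp] theorem insertFirst_succAbove (z : Fin (N + 1)) (τ : Equiv.Perm (Fin N)) (i : Fin N) :
    insertFirst z τ (z.succAbove i) = (τ i).succ := by simp [insertFirst]

@[simp] theorem insertFirst_symm_zero (z : Fin (N + 1)) (τ : Equiv.Perm (Fin N)) :
    (insertFirst z τ).symm 0 = z := by simp [Equiv.symm_apply_eq]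

@[simp] theorem insertFirst_symm_succ (z : Fin (N + 1)) (τ : Equiv.Perm (Fin N)) (i : Fin N) :
    (insertFirst z τ).symm i.succ = z.succAbove (τ.symm i) := by simp [Equiv.symm_apply_eq]

/-- Permutations of `Fin (N + 1)` are determined by the preimage of `0` and a permutation of
`Fin N`. -/
noncomputable def insertFirstEquiv : Fin (N + 1) × Equiv.Perm (Fin N) ≃ Equiv.Perm (Fin (N + 1)) :=
  Equiv.ofBijective (fun x => insertFirst x.1 x.2) <| by
    rw [Fintype.bijective_iff_injective_and_card]
    refine ⟨?_, by simp [Fintype.card_perm, Nat.factorial_succ]⟩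
    rintro ⟨z, τ⟩ ⟨z', τ'⟩ hz
    dsimp only at hz
    obtain rfl : z = z' := by
      rw [← insertFirst_symm_zero z τ, hz, insertFirst_symm_zero]
    congr 1
    ext i
    have := congrArg (fun σ => σ (z.succAbove i)) hz
    simp only [insertFirst_succAbove, Fin.succ_inj] at this
    rw [this]

/-- `σ` is increasing on the first `p` indices and on the other indices. -/
def IsBlockShuffle (p : ℕ) (σ : Equiv.Perm (Fin N)) : Prop :=
  StrictMonoOn σ {i | (i : ℕ) < p} ∧ StrictMonoOn σ {i | p ≤ (i : ℕ)}

/-- The first letter of a shuffle is the first letter of one of the two blocks. -/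
theorem IsBlockShuffle.first {p : ℕ} {z : Fin (N + 1)} {τ : Equiv.Perm (Fin N)}
    (h : IsBlockShuffle p (insertFirst z τ)) : (z : ℕ) = 0 ∧ 0 < p ∨ (z : ℕ) = p := by
  rcases lt_or_ge (z : ℕ) p with hz | hz
  · refine Or.inl ⟨?_, by omega⟩
    by_contra h0
    have := h.1 (show (0 : Fin (N + 1)) ∈ {i : Fin (N + 1) | (i : ℕ) < p} by simp; omega) hz 
      (Fin.pos_iff_ne_zero.2 fun e => h0 (by simp [e]))
    simp at this
  · refine Or.inr ?_
    by_contra h0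
    have hp : p < N + 1 := by omega
    have := h.2 (show (⟨p, hp⟩ : Fin (N + 1)) ∈ {i : Fin (N + 1) | p ≤ (i : ℕ)} by simp) hz
      (by rw [Fin.lt_def]; simp; omega)
    simp at this

/-- Removing the first letter of a shuffle leaves a shuffle of the remaining letters. -/
theorem isBlockShuffle_insertFirst {p q : ℕ} {z : Fin (N + 1)} {τ : Equiv.Perm (Fin N)}
    (hz : (z : ℕ) = 0 ∧ p = q + 1 ∨ (z : ℕ) = p ∧ p = q) :
    IsBlockShuffle p (insertFirst z τ) ↔ IsBlockShuffle q τ := by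
  have hlt : ∀ i : Fin N, ((z.succAbove i : Fin (N + 1)) : ℕ) < p ↔ (i : ℕ) < q := by
    intro i
    simp only [Fin.succAbove, Fin.lt_def]
    split_ifs with h <;> simp at h ⊢ <;> omega
  constructor
  · rintro ⟨h1, h2⟩
    refine ⟨fun i hi j hj hij => ?_, fun i hi j hj hij => ?_⟩
    · have := h1 (a := z.succAbove i) (b := z.succAbove j) ((hlt i).2 hi) ((hlt j).2 hj)
        (Fin.succAbove_lt_succAbove_iff.2 hij)
      simpa using this
    · have := h2 (a := z.succAbove i) (b := z.succAbove j)
        (not_lt.1 fun h => not_lt.2 hi ((hlt i).1 h))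
        (not_lt.1 fun h => not_lt.2 hj ((hlt j).1 h))
        (Fin.succAbove_lt_succAbove_iff.2 hij)
      simpa using this
  · rintro ⟨h1, h2⟩
    refine ⟨fun i hi j hj hij => ?_, fun i hi j hj hij => ?_⟩
    · rcases eq_or_ne j z with rfl | hjz
      · exfalso
        simp only [Set.mem_ofPred_eq] at hi hj
        have := Fin.lt_def.1 hij
        omega
      obtain ⟨j, rfl⟩ := Fin.exists_succAbove_eq hjz
      rcases eq_or_ne i z with rfl | hiz
      · simp
      obtain ⟨i, rfl⟩ := Fin.exists_succAbove_eq hiz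
      simp only [insertFirst_succAbove, Fin.succ_lt_succ_iff]
      exact h1 ((hlt i).1 hi) ((hlt j).1 hj) (Fin.succAbove_lt_succAbove_iff.1 hij)
    · rcases eq_or_ne j z with rfl | hjz
      · exfalso
        simp only [Set.mem_ofPred_eq] at hi hj
        have := Fin.lt_def.1 hij
        omega
      obtain ⟨j, rfl⟩ := Fin.exists_succAbove_eq hjz
      rcases eq_or_ne i z with rfl | hiz
      · simp
      obtain ⟨i, rfl⟩ := Fin.exists_succAbove_eq hiz
      simp only [insertFirst_succAbove, Fin.succ_lt_succ_iff]
      exact h2 (not_lt.1 fun h => not_lt.2 hi ((hlt i).2 h))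
        (not_lt.1 fun h => not_lt.2 hj ((hlt j).2 h)) (Fin.succAbove_lt_succAbove_iff.1 hij)

variable {X W : Type*} [AddCommGroup W]

/-- The sum of `e (c i) (c j)` over the inversions `(i, j)` of `σ`. -/
def inversionSum (e : X → X → ℤ) (c : Fin N → X) (σ : Equiv.Perm (Fin N)) : ℤ :=
  ∑ i, ∑ j, if i < j ∧ σ j < σ i then e (c i) (c j) else 0

theorem inversionSum_insertFirst (e : X → X → ℤ) (c : Fin (N + 1) → X) (z : Fin (N + 1))
    (τ : Equiv.Perm (Fin N)) :
    inversionSum e c (insertFirst z τ) =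
      (((List.ofFn c).take z).map fun x => e x (c z)).sum +
        inversionSum e (c ∘ z.succAbove) τ := by
  have h1 : ∀ (M : ℕ) (f : Fin M → ℤ) (p : ℕ),
      ((List.ofFn f).take p).sum = ∑ i : Fin M, if (i : ℕ) < p then f i else 0 := by
    intro M
    induction M with
    | zero => simp
    | succ M ih =>
      intro f p
      cases p with
      | zero => simp
      | succ p => simp [List.ofFn_succ, Fin.sum_univ_succ, ih]
  rw [List.map_take, List.map_ofFn, h1, inversionSum, inversionSum, Fin.sum_univ_succAbove _ z,
    Fin.sum_univ_succAbove _ z]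
  simp only [Fin.sum_univ_succAbove _ z, insertFirst_self, insertFirst_succAbove,
    Fin.succAbove_lt_succAbove_iff, Fin.succ_lt_succ_iff, Fin.not_lt_zero, and_false,
    Fin.succ_pos, and_true, if_false, Finset.sum_const_zero, zero_add, lt_irrefl,
    Finset.sum_add_distrib, Function.comp_apply, Fin.val_fin_lt]

open Classical in
/-- The sum over the shuffle permutations, as a sum over the shuffles of two words. -/
theorem sum_isBlockShuffle (e : X → X → ℤ) (p : ℕ) (hp : p ≤ N) (c : Fin N → X)
    (G : List X → W) :
    ∑ σ : Equiv.Perm (Fin N) with IsBlockShuffle p σ,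
      (inversionSum e c σ).negOnePow • G (List.ofFn (c ∘ σ.symm)) =
    shuffleSum (fun x y => (e x y).negOnePow) G ((List.ofFn c).take p) ((List.ofFn c).drop p) := by
  induction N generalizing p G with
  | zero =>
    have : ∀ σ : Equiv.Perm (Fin 0), IsBlockShuffle p σ := fun σ =>
      ⟨fun i => i.elim0, fun i => i.elim0⟩
    simp [this, inversionSum]
  | succ N ih =>
    -- The permutations are sorted by the index `z` of the letter moved to the first position.
    have hz : ∀ z : Fin (N + 1), ∀ q ≤ N, ((z : ℕ) = 0 ∧ p = q + 1 ∨ (z : ℕ) = p ∧ p = q) →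
        (∑ τ : Equiv.Perm (Fin N), if IsBlockShuffle p (insertFirst z τ) then
          (inversionSum e c (insertFirst z τ)).negOnePow •
            G (List.ofFn (c ∘ (insertFirst z τ).symm)) else 0) =
        (((List.ofFn c).take z).map fun x => (e x (c z)).negOnePow).prod •
          shuffleSum (fun x y => (e x y).negOnePow) (fun l => G (c z :: l))
            ((List.ofFn (c ∘ z.succAbove)).take q) ((List.ofFn (c ∘ z.succAbove)).drop q) := by
      intro z q hq hzq
      rw [← ih q hq, ← Finset.sum_filter, Finset.smul_sum, prod_map_negOnePow]
      refine Finset.sum_congr (by ext τ; simp [isBlockShuffle_insertFirst hzq]) fun τ _ => ?_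
      rw [inversionSum_insertFirst, Int.negOnePow_add, mul_smul]
      congr 3
      simp [List.ofFn_succ, Function.comp_def]
    have hother : ∀ z : Fin (N + 1), ¬((z : ℕ) = 0 ∧ 0 < p ∨ (z : ℕ) = p) →
        (∑ τ : Equiv.Perm (Fin N), if IsBlockShuffle p (insertFirst z τ) then
          (inversionSum e c (insertFirst z τ)).negOnePow •
            G (List.ofFn (c ∘ (insertFirst z τ).symm)) else 0) = 0 := fun z hz =>
      Finset.sum_eq_zero fun τ _ => if_neg fun h => hz h.first
    have hzero : ∀ c : Fin (N + 1) → X, c ∘ (0 : Fin (N + 1)).succAbove = fun i => c i.succ := by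
      intro c; ext i; simp
    rw [Finset.sum_filter, ← insertFirstEquiv.sum_comp, Fintype.sum_prod_type]
    simp only [insertFirstEquiv, Equiv.ofBijective_apply]
    rcases Nat.eq_zero_or_pos p with rfl | hp0
    · rw [Fintype.sum_eq_single 0 fun z hz0 => hother z (by
        rintro (⟨-, h⟩ | h)
        · exact lt_irrefl _ h
        · exact hz0 (Fin.ext h)), hz 0 0 (Nat.zero_le _) (Or.inr ⟨rfl, rfl⟩), hzero]
      simp [List.ofFn_succ]
    obtain ⟨q, rfl⟩ : ∃ q, p = q + 1 := ⟨p - 1, by omega⟩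
    rcases hp.lt_or_eq with hlt | heq
    · have hne : (0 : Fin (N + 1)) ≠ ⟨q + 1, hlt⟩ := by simp [Fin.ext_iff]
      rw [Fintype.sum_eq_add _ _ hne fun z hz0 => hother z (by
        rintro (⟨h, -⟩ | h)
        · exact hz0.1 (Fin.ext h)
        · exact hz0.2 (Fin.ext h)), hz 0 q (by omega) (Or.inl ⟨rfl, rfl⟩),
        hz ⟨q + 1, hlt⟩ (q + 1) (by omega) (Or.inr ⟨rfl, rfl⟩), hzero]
      have e1 : (List.ofFn c).drop (q + 1) =
          c ⟨q + 1, hlt⟩ :: (List.ofFn (c ∘ Fin.succAbove ⟨q + 1, hlt⟩)).drop (q + 1) := by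
        rw [List.drop_eq_getElem_cons (by simpa using hlt)]
        congr 1
        · simp
        · refine List.ext_getElem (by simp) fun i h1 h2 => ?_
          simp only [List.getElem_drop, List.getElem_ofFn, Function.comp_apply]
          congr 1
          rw [Fin.succAbove_of_le_castSucc _ _ (by simp [Fin.le_def])]
          ext
          simp
          omega
      have e2 : (List.ofFn (c ∘ Fin.succAbove ⟨q + 1, hlt⟩)).take (q + 1) =
          (List.ofFn c).take (q + 1) := by
        refine List.ext_getElem (by simp; omega) fun i h1 h2 => ?_
        simp only [List.getElem_take, List.getElem_ofFn, Function.comp_apply]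
        congr 1
        ext
        have : i < q + 1 := by simp at h2; omega
        simp [Fin.succAbove, Fin.lt_def, this]
      rw [e2]
      have e3 : (List.ofFn c).take (q + 1) =
          c 0 :: (List.ofFn fun i : Fin N => c i.succ).take q := by simp [List.ofFn_succ]
      have e4 : (List.ofFn fun i : Fin N => c i.succ).drop q = (List.ofFn c).drop (q + 1) := by
        simp [List.ofFn_succ]
      rw [e4, e1]
      simp only [e3]
      rw [shuffleSum_cons_cons]
      simp
    · rw [Fintype.sum_eq_single 0 fun z hz0 => hother z (by
        rintro (⟨h, -⟩ | h)
        · exact hz0 (Fin.ext h)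
        · omega), hz 0 q (by omega) (Or.inl ⟨rfl, rfl⟩), hzero]
      have e1 : ∀ M (f : Fin M → X), (List.ofFn f).drop M = [] := by simp
      obtain rfl : q = N := by omega
      rw [e1, e1]
      simp [List.ofFn_succ]

end ShufflePermutations

/-! ### Desuspension of operations -/

section SuspendedOperations

variable {K : Type*} [Field K] {V W X : Type*} [AddCommGroup V] [Module K V]
  [AddCommGroup W] [Module K W]

theorem IsSlotLinear.units_smul {g : List V → W} (hg : IsSlotLinear K g) (u : List V) (c : ℤˣ)
    (x : V) (w : List V) : g (u ++ (c • x) :: w) = c • g (u ++ x :: w) := by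
  rw [Units.smul_def, Units.smul_def, ← Int.cast_smul_eq_zsmul K, ← Int.cast_smul_eq_zsmul K,
    hg.smul]

theorem IsSlotLinear.cons {g : List V → W} (hg : IsSlotLinear K g) (x : V) :
    IsSlotLinear K fun l => g (x :: l) where
  add u y z w := hg.add (x :: u) y z w
  smul u c y w := hg.smul (x :: u) c y w

/-- The component of arity `k` of a slot-linear function of words. -/
def IsSlotLinear.toMultilinearMap {g : List V → W} (hg : IsSlotLinear K g) (k : ℕ) :
    MultilinearMap K (fun _ : Fin k => V) W :=
  have key : ∀ [DecidableEq (Fin k)] (a : Fin k → V) (i : Fin k) (x : V),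
      List.ofFn (Function.update a i x) =
        (List.ofFn a).take i ++ x :: (List.ofFn a).drop (i + 1) := by
    intro _ a i x
    have : List.ofFn (Function.update a i x) = (List.ofFn a).set i x := by
      refine List.ext_getElem (by simp) fun j h1 h2 => ?_
      simp only [List.getElem_ofFn, List.getElem_set, Function.update_apply, Fin.ext_iff, eq_comm]
    rw [this, List.set_eq_take_append_cons_drop, if_pos (by simp)]
  { toFun := fun a => g (List.ofFn a)
    map_update_add' := fun a i x y => by rw [key, key, key, hg.add]
    map_update_smul' := fun a i c x => by rw [key, key, hg.smul] }

/-- The operations given by a slot-linear function of words, desuspended by means of the degree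
involution `ε`: the operation of arity `k` sends `a_0, …, a_{k-1}` to `g` of the word
`ε^{k-1} a_0, ε^{k-2} a_1, …, a_{k-1}`. -/
def IsSlotLinear.operations {g : List V → W} (hg : IsSlotLinear K g) (ε : V →ₗ[K] V) :
    Operations K V W := fun k =>
  (hg.toMultilinearMap k).compLinearMap fun j => ε ^ (k - 1 - (j : ℕ))

theorem IsSlotLinear.operations_apply {g : List V → W} (hg : IsSlotLinear K g) (ε : V →ₗ[K] V)
    (k : ℕ) (a : Fin k → V) :
    hg.operations ε k a = g (List.ofFn fun j => (ε ^ (k - 1 - (j : ℕ))) (a j)) := rfl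

variable {g : List V → W} {ε : V →ₗ[K] V} {val : X → V} {deg : X → ℤ}

theorem IsSlotLinear.operations_apply_letters (hg : IsSlotLinear K g)
    (hε : ∀ x, ε (val x) = (deg x).negOnePow • val x) {k : ℕ} (l : Fin k → X) :
    hg.operations ε k (fun j => val (l j)) =
      (suspExponent deg (List.ofFn l)).negOnePow • g ((List.ofFn l).map val) := by
  have hpow : ∀ (m : ℕ) x, (ε ^ m) (val x) = (m * deg x).negOnePow • val x := by
    intro m x
    induction m with
    | zero => simp
    | succ m ih =>
      rw [pow_succ', Module.End.mul_apply, ih, map_units_int_smul, hε, smul_smul,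
        ← Int.negOnePow_add]
      congr 2
      push_cast; ring
  rw [hg.operations_apply]
  induction k generalizing g with
  | zero => simp [suspExponent]
  | succ k ih =>
    have h1 := ih (hg.cons (val (l 0))) fun i => l i.succ
    simp only [List.ofFn_succ, List.map_cons, suspExponent, Fin.val_zero, Fin.val_succ,
      List.length_ofFn]
    have h2 : ∀ j : Fin k, k + 1 - 1 - ((j : ℕ) + 1) = k - 1 - j := fun j => by omega
    simp only [h2, hpow _ (l 0)]
    have h3 := hg.units_smul []
    simp only [List.nil_append] at h3
    rw [h3, h1, smul_smul, Int.negOnePow_add]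
    rfl

theorem IsSlotLinear.operations_range' {a : ℕ → V} {deg : ℕ → ℤ} (hg : IsSlotLinear K g)
    (hε : ∀ i, ε (a i) = (deg i).negOnePow • a i) (s k : ℕ) :
    hg.operations ε k (fun j : Fin k => a (s + j)) =
      (suspExponent deg (List.range' s k)).negOnePow • g ((List.range' s k).map a) := by
  have h1 : List.ofFn (fun j : Fin k => s + (j : ℕ)) = List.range' s k :=
    List.ext_getElem (by simp) (by simp)
  rw [hg.operations_apply_letters hε fun j : Fin k => s + (j : ℕ), h1]

theorem IsSlotLinear.map_signs (hg : IsSlotLinear K g) {τ : V → V} {s : X → ℤ}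
    (hτ : ∀ x, τ (val x) = (s x).negOnePow • val x) (u : List X) (w : List V) :
    g ((u.map val).map τ ++ w) = ((u.map s).sum).negOnePow • g (u.map val ++ w) := by
  induction u generalizing g with
  | nil => simp
  | cons x u ih =>
    have h3 := hg.units_smul []
    simp only [List.nil_append] at h3
    simp only [List.map_cons, List.cons_append, List.sum_cons]
    rw [hτ, h3, ih (hg.cons _), smul_smul, Int.negOnePow_add]

theorem suspExponent_map {Y : Type*} (deg : Y → ℤ) (f : X → Y) (l : List X) :
    suspExponent deg (l.map f) = suspExponent (fun x => deg (f x)) l := by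
  induction l with
  | nil => rfl
  | cons x l ih => simp [suspExponent, ih]

theorem map_range'_insert {Y : Type*} (b : ℕ → Y) (y : Y) {p k l : ℕ} (hk : 1 ≤ k)
    (hl : l + k ≤ p) :
    (List.range' 0 (p - k + 1)).map
        (fun i => if i < l then b i else if i = l then y else b (i + k - 1)) =
      (List.range' 0 l).map b ++ y :: (List.range' (l + k) (p - l - k)).map b := by
  refine List.ext_getElem (by simp; omega) fun i h1 h2 => ?_
  simp only [List.getElem_map, List.getElem_range', List.getElem_append, List.length_map,
    List.length_range', List.getElem_cons, zero_add, one_mul]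
  split_ifs with h3 h4 h5 h6
  · rfl
  · rfl
  · omega
  · omega
  · congr 1; omega

theorem range'_split {p k l : ℕ} (hl : l + k ≤ p) :
    List.range' 0 p = List.range' 0 l ++ (List.range' l k ++ List.range' (l + k) (p - l - k)) := by
  rw [List.range'_append_1, ← zero_add l, zero_add l]
  conv_rhs => rw [show List.range' l (k + (p - l - k)) = List.range' (0 + l) (p - l) by
    congr 1 <;> omega]
  rw [List.range'_append_1]
  congr 1; omega

theorem splitSum_range' {M : Type*} [AddCommMonoid M] (G : List ℕ → List ℕ → M) (s p : ℕ) :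
    splitSum G (List.range' s p) =
      ∑ i ∈ Finset.range (p + 1), G (List.range' s i) (List.range' (s + i) (p - i)) := by
  rw [splitSum_eq_sum_range, List.length_range']
  refine Finset.sum_congr rfl fun i hi => ?_
  have hi := Finset.mem_range_succ_iff.1 hi
  congr 1
  · exact List.ext_getElem (by simp; omega) (by simp)
  · exact List.ext_getElem (by simp) (by simp [add_assoc])

theorem sum_map_range' (deg : ℕ → ℤ) (s l : ℕ) :
    ((List.range' s l).map deg).sum = ∑ i ∈ Finset.range l, deg (s + i) := by
  induction l generalizing s with
  | zero => simp
  | succ l ih =>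
    rw [Finset.sum_range_succ', List.range'_succ, List.map_cons, List.sum_cons, ih, add_comm]
    simp only [add_assoc, add_comm 1, add_zero]

/-- A multilinear map which vanishes on homogeneous elements is zero. -/
theorem MultilinearMap.eq_zero_of_homogeneous {𝒱 : ℤ → Submodule K V}
    (h𝒱 : DirectSum.IsInternal 𝒱) {k : ℕ} (f : MultilinearMap K (fun _ : Fin k => V) W)
    (H : ∀ (deg : Fin k → ℤ) (a : Fin k → V), (∀ i, a i ∈ 𝒱 (deg i)) → f a = 0) : f = 0 := by
  have key : ∀ (S : Finset (Fin k)) (a : Fin k → V), (∀ i ∉ S, ∃ j, a i ∈ 𝒱 j) → f a = 0 := by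
    intro S
    induction S using Finset.induction_on with
    | empty =>
      intro a ha
      choose deg hdeg using fun i => ha i (Finset.notMem_empty i)
      exact H deg a hdeg
    | insert i S hi ih =>
      intro a ha
      have hai : a i ∈ ⨆ j, 𝒱 j := by
        rw [h𝒱.submodule_iSup_eq_top]; trivial
      have : ∀ x ∈ ⨆ j, 𝒱 j, f (Function.update a i x) = 0 := by
        intro x hx
        induction hx using Submodule.iSup_induction' with
        | mem j x hx =>
          refine ih _ fun i' hi' => ?_
          by_cases e : i' = i
          · subst e; exact ⟨j, by simpa using hx⟩
          · rw [Function.update_of_ne e]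
            exact ha i' (by simp [e, hi'])
        | zero => exact f.map_update_zero a i
        | add x y _ _ h1 h2 => rw [f.map_update_add, h1, h2, add_zero]
      simpa using this _ hai
  ext a
  exact key Finset.univ a (by simp)

/-- The composition of `p` with the two blocks `i` and `p - i`. -/
def pairComposition {p i : ℕ} (h0 : 0 < i) (hp : i < p) : Composition p where
  blocks := [i, p - i]
  blocks_pos := by
    intro j hj
    simp only [List.mem_cons, List.not_mem_nil, or_false] at hj
    omega
  blocks_sum := by simp; omega

/-- A sum over compositions in which only those with at most two blocks contribute. -/
theorem sum_composition_eq {M : Type*} [AddCommMonoid M] {p : ℕ} (hp : 0 < p)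
    (G : Composition p → M) (hG : ∀ c, c.length ≠ 1 → c.length ≠ 2 → G c = 0) :
    ∑ c, G c = G (Composition.single p hp) +
      ∑ i : Fin (p - 1), G (pairComposition (p := p) (i := i + 1) (by omega) (by omega)) := by
  have := Fintype.sum_of_injective (fun o : Option (Fin (p - 1)) => o.elim
    (Composition.single p hp)
    fun i => pairComposition (p := p) (i := i + 1) (by omega) (by omega)) ?_ _ G ?_ fun _ => rfl
  · rw [← this, Fintype.sum_option]
    rfl
  · rintro (_ | i) (_ | j) h
    · rfl
    · exact absurd (congrArg Composition.length h) (by simp [pairComposition, Composition.length])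
    · exact absurd (congrArg Composition.length h) (by simp [pairComposition, Composition.length])
    · have := congrArg Composition.blocks h
      simp only [Option.elim_some, pairComposition, List.cons.injEq] at this
      exact congrArg some (Fin.ext (by omega))
  · intro c hc
    refine hG c (fun h1 => hc ⟨none, ?_⟩) fun h2 => ?_
    · exact ((Composition.eq_single_iff_length hp).2 h1).symm
    · obtain ⟨i, j, hij⟩ := List.length_eq_two.1 h2
      have hi : 0 < i := c.blocks_pos (by simp [hij])
      have hj : 0 < j := c.blocks_pos (by simp [hij])
      have hs := c.blocks_sum
      rw [hij] at hs
      simp only [List.sum_cons, List.sum_nil, add_zero] at hs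
      refine hc ⟨some ⟨i - 1, by omega⟩, Composition.ext ?_⟩
      simp only [Option.elim_some, pairComposition, hij]
      rw [show i - 1 + 1 = i by omega, show p - i = j by omega]

open Classical in
/-- Operations of the suspended kind vanish on shuffles if their word functions do. -/
theorem IsSlotLinear.vanishesOnShuffles {𝒱 : ℤ → Submodule K V} (hg : IsSlotLinear K g)
    (hε : ∀ i, ∀ x ∈ 𝒱 i, ε x = i.negOnePow • x)
    (hsh : ∀ (k : ℕ) (val : Fin k → V) (deg : Fin k → ℤ), (∀ x, val x ∈ 𝒱 (deg x)) →
      ∀ x u y v, shuffleSum (fun x y => ((deg x - 1) * (deg y - 1)).negOnePow)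
        (fun l => g (l.map val)) (x :: u) (y :: v) = 0) :
    VanishesOnShuffles 𝒱 (hg.operations ε) := by
  intro p q hp hq deg a ha
  have key := sum_isBlockShuffle (fun x y => 1 + deg x * deg y) p (Nat.le_add_right p q)
    (id : Fin (p + q) → Fin (p + q))
    (fun l => (suspExponent deg l).negOnePow • g (l.map a))
  have e : ∀ σ : Equiv.Perm (Fin (p + q)), hg.operations ε (p + q) (fun i => a (σ.symm i)) =
      (suspExponent deg (List.ofFn (id ∘ σ.symm))).negOnePow •
        g ((List.ofFn (id ∘ σ.symm)).map a) := fun σ =>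
    hg.operations_apply_letters (fun x => hε _ _ (ha x)) σ.symm
  simp only [e]
  refine Eq.trans ?_ (key.trans ?_)
  · rfl
  · rw [shuffleSum_suspExponent]
    generalize hu : (List.ofFn (id : Fin (p + q) → Fin (p + q))).take p = u
    generalize hv : (List.ofFn (id : Fin (p + q) → Fin (p + q))).drop p = v
    have hu' := congrArg List.length hu
    have hv' := congrArg List.length hv
    simp only [List.length_take, List.length_drop, List.length_ofFn] at hu' hv'
    match u, v with
    | [], _ => simp at hu'; omega
    | _, [] => simp at hv'; omega
    | x :: u, y :: v => rw [hsh _ a deg ha, smul_zero]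

end SuspendedOperations

/-! ### The transferred structure as a `C∞`-algebra -/

namespace DGCA

variable {K : Type u} [Field K] (A : DGCA.{u, v} K)

theorem operations_one (x : Fin 1 → A.carrier) : A.operations 1 x = A.d (x 0) := by
  change A.d (MultilinearMap.mkPiAlgebraFin K 1 A.carrier x) = _
  simp [MultilinearMap.mkPiAlgebraFin_apply]

theorem operations_two (x : Fin 2 → A.carrier) : A.operations 2 x = x 0 * x 1 := by
  change MultilinearMap.mkPiAlgebraFin K 2 A.carrier x = _
  simp [MultilinearMap.mkPiAlgebraFin_apply, List.ofFn_succ]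

end DGCA

namespace PoincareDGCA

namespace HodgeHomotopy

variable {K : Type u} [Field K] {n : ℕ} {A : PoincareDGCA.{u, v} K n} (h : A.HodgeHomotopy)

/-- The transferred `C∞`-structure on the harmonic subspace. -/
noncomputable def model : Operations K h.harmonic h.harmonic :=
  h.isSlotLinear_transferred.operations h.harmonicParity

/-- The `C∞`-morphism from the harmonic subspace to `A`. -/
noncomputable def modelMap : Operations K h.harmonic A.carrier :=
  h.isSlotLinear_twisting.operations h.harmonicParity

variable {h}

theorem harmonicParity_of_mem {i : ℤ} {x : h.harmonic} (hx : x ∈ h.harmonicGr i) :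
    h.harmonicParity x = i.negOnePow • x := by
  ext
  rw [coe_harmonicParity, DGCA.parity_of_mem (show (x : A.carrier) ∈ A.gr i from hx)]
  rfl

theorem suspParity_of_mem {i : ℤ} {x : h.harmonic} (hx : x ∈ h.harmonicGr i) :
    h.suspParity x = (i - 1).negOnePow • x := by
  rw [suspParity, LinearMap.neg_apply, harmonicParity_of_mem hx, Int.negOnePow_sub]
  simp

/-- The signs in the structure equations of `C∞`-algebras and morphisms are those obtained from the
suspended operations. -/
theorem insertOp_term {W : Type*} [AddCommGroup W] [Module K W] {g : List h.harmonic → W}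
    (hg : IsSlotLinear K g) {a : ℕ → h.harmonic} {deg : ℕ → ℤ}
    (ha : ∀ i, a i ∈ h.harmonicGr (deg i)) {p k l : ℕ} (hk : 1 ≤ k) (hl : l + k ≤ p) :
    ((l : ℤ) + k * (p - l - k) + k * ∑ i ∈ Finset.range l, deg i).negOnePow •
      hg.operations h.harmonicParity (p - k + 1) (fun i => insertOp h.model a l k i) =
    (suspExponent deg (List.range' 0 p)).negOnePow •
      g (((List.range' 0 l).map a).map h.suspParity ++
        h.transferred ((List.range' l k).map a) :: (List.range' (l + k) (p - l - k)).map a) := by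
  have hε : ∀ i, h.harmonicParity (a i) = (deg i).negOnePow • a i := fun i =>
    harmonicParity_of_mem (ha i)
  have hv : h.model k (fun j => a (l + j)) = _ :=
    h.isSlotLinear_transferred.operations_range' hε l k
  have hvmem := transferred_mem ha (List.range' l k)
  set dm : ℤ := ((List.range' l k).map deg).sum + 2 - (List.range' l k).length with hdm
  set y := h.model k (fun j => a (l + j)) with hy
  have hymem : y ∈ h.harmonicGr dm := by
    rw [hv, Units.smul_def]
    exact zsmul_mem hvmem _
  let deg' : ℕ → ℤ := fun i => if i < l then deg i else if i = l then dm else deg (i + k - 1)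
  have hins : ∀ i, insertOp h.model a l k i ∈ h.harmonicGr (deg' i) := by
    intro i
    simp only [insertOp, deg']
    split_ifs
    · exact ha i
    · exact hymem
    · exact ha _
  have h1 := hg.operations_range' (fun i => harmonicParity_of_mem (hins i)) 0 (p - k + 1)
  simp only [zero_add] at h1
  have h2 : (List.range' 0 (p - k + 1)).map (insertOp h.model a l k) =
      (List.range' 0 l).map a ++ y :: (List.range' (l + k) (p - l - k)).map a :=
    map_range'_insert a y hk hl
  have h3 : (List.range' 0 (p - k + 1)).map deg' =
      (List.range' 0 l).map deg ++ dm :: (List.range' (l + k) (p - l - k)).map deg :=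
    map_range'_insert deg dm hk hl
  have h4 : suspExponent deg' (List.range' 0 (p - k + 1)) =
      suspExponent id ((List.range' 0 (p - k + 1)).map deg') := (suspExponent_map id _ _).symm
  have h5 : suspExponent deg (List.range' 0 p) = suspExponent id ((List.range' 0 p).map deg) :=
    (suspExponent_map id _ _).symm
  have h6 : suspExponent deg (List.range' l k) = suspExponent id ((List.range' l k).map deg) :=
    (suspExponent_map id _ _).symm
  have hsgn := hg.map_signs (fun i => suspParity_of_mem (ha i)) (List.range' 0 l)
    (h.transferred ((List.range' l k).map a) :: (List.range' (l + k) (p - l - k)).map a)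
  have h7 : ((List.range' 0 l).map fun i => deg i - 1).sum =
      ((List.range' 0 l).map deg).sum - l := by
    rw [sum_map_range', sum_map_range']; simp
  rw [h1, h2, hv, hg.units_smul, hsgn, h7, h4, h3, h5, h6, range'_split hl, smul_smul, smul_smul,
    smul_smul, ← Int.negOnePow_add, ← Int.negOnePow_add, ← Int.negOnePow_add]
  congr 1
  rw [Int.negOnePow_eq_iff]
  have h8 : ∑ i ∈ Finset.range l, deg i = ((List.range' 0 l).map deg).sum := by
    rw [sum_map_range']; simp
  have h9 : ((p - l - k : ℕ) : ℤ) = p - l - k := by omega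
  rw [h8]
  simp only [List.map_append, suspExponent_append, suspExponent, List.map_id, List.length_map,
    List.length_cons, List.length_append, List.length_range', id, hdm]
  push_cast
  rw [h9]
  refine ⟨l + (p - l - k), ?_⟩
  ring

/-- The left hand sides of the structure equations of `C∞`-algebras and morphisms. -/
theorem sum_insertOp {W : Type*} [AddCommGroup W] [Module K W] {g : List h.harmonic → W}
    (hg : IsSlotLinear K g) {a : ℕ → h.harmonic} {deg : ℕ → ℤ}
    (ha : ∀ i, a i ∈ h.harmonicGr (deg i)) (p : ℕ) :
    ∑ k ∈ Finset.Icc 1 p, ∑ l ∈ Finset.range (p - k + 1),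
      ((l : ℤ) + k * (p - l - k) + k * ∑ i ∈ Finset.range l, deg i).negOnePow •
        hg.operations h.harmonicParity (p - k + 1) (fun i => insertOp h.model a l k i) =
    (suspExponent deg (List.range' 0 p)).negOnePow •
      h.insertSum g ((List.range' 0 p).map a) := by
  have h1 : ∀ k ∈ Finset.Icc 1 p, ∀ l ∈ Finset.range (p - k + 1),
      ((l : ℤ) + k * (p - l - k) + k * ∑ i ∈ Finset.range l, deg i).negOnePow •
        hg.operations h.harmonicParity (p - k + 1) (fun i => insertOp h.model a l k i) =
      (suspExponent deg (List.range' 0 p)).negOnePow •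
        g (((List.range' 0 l).map a).map h.suspParity ++
          h.transferred ((List.range' l k).map a) ::
            (List.range' (l + k) (p - l - k)).map a) := by
    intro k hk l hl
    rw [Finset.mem_Icc] at hk
    rw [Finset.mem_range] at hl
    exact insertOp_term hg ha hk.1 (by omega)
  rw [Finset.sum_congr rfl fun k hk => Finset.sum_congr rfl (h1 k hk)]
  simp only [← Finset.smul_sum]
  congr 1
  simp only [insertSum, splitSum_map, splitSum_range', zero_add]
  have h2 : ∀ l, ∑ k ∈ Finset.range (p - l + 1),
      g (((List.range' 0 l).map a).map h.suspParity ++ h.transferred ((List.range' l k).map a) ::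
            (List.range' (l + k) (p - l - k)).map a) =
      ∑ k ∈ Finset.Icc 1 (p - l),
      g (((List.range' 0 l).map a).map h.suspParity ++ h.transferred ((List.range' l k).map a) ::
            (List.range' (l + k) (p - l - k)).map a) := by
    intro l
    refine (Finset.sum_subset (fun k hk => ?_) fun k hk hk' => ?_).symm
    · rw [Finset.mem_Icc] at hk
      rw [Finset.mem_range]
      omega
    · rw [Finset.mem_Icc] at hk'
      rw [Finset.mem_range] at hk
      obtain rfl : k = 0 := by omega
      simp [hg.zero]
  rw [Finset.sum_congr rfl fun l _ => h2 l]
  refine Finset.sum_comm' fun k l => ?_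
  simp only [Finset.mem_Icc, Finset.mem_range]
  omega

/-- The right hand side of the structure equation of `C∞`-morphisms to a DGCA. -/
theorem sum_composition_operations {a : ℕ → h.harmonic} {deg : ℕ → ℤ}
    (ha : ∀ i, a i ∈ h.harmonicGr (deg i)) {p : ℕ} (hp : 1 ≤ p) :
    ∑ c : Composition p, (morphismExponent c deg).negOnePow •
      A.operations c.length (fun α => h.modelMap (c.blocksFun α)
        (fun j => a (c.sizeUpTo α + j))) =
    (suspExponent deg (List.range' 0 p)).negOnePow •
      (A.d (h.twisting ((List.range' 0 p).map a)) +
        cupSq A h.twisting ((List.range' 0 p).map a)) := by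
  have hε : ∀ i, h.harmonicParity (a i) = (deg i).negOnePow • a i := fun i =>
    harmonicParity_of_mem (ha i)
  have hf : ∀ s k, h.modelMap k (fun j => a (s + j)) = _ := fun s k =>
    h.isSlotLinear_twisting.operations_range' hε s k
  rw [sum_composition_eq (by omega), smul_add]
  · congr 1
    · have h1 : A.operations (Composition.single p (by omega)).length (fun α => h.modelMap
          ((Composition.single p (by omega)).blocksFun α)
          (fun j => a ((Composition.single p (by omega)).sizeUpTo α + j))) =
          A.d (h.modelMap p (fun j => a (0 + j))) :=
        A.operations_one _
      have h2 : morphismExponent (Composition.single p (by omega)) deg = 0 := by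
        refine Finset.sum_eq_zero fun i _ => Finset.sum_eq_zero fun j _ => if_neg ?_
        have hi := i.2
        have hj := j.2
        simp only [Composition.single_length] at hi hj
        rw [Fin.lt_def]
        omega
      rw [h1, h2, hf, map_units_int_smul]
      simp
    · have h3 : ∀ i : ℕ, ∀ (h0 : 0 < i) (hi : i < p),
          (morphismExponent (pairComposition h0 hi) deg).negOnePow •
            A.operations (pairComposition h0 hi).length (fun α => h.modelMap
              ((pairComposition h0 hi).blocksFun α)
              (fun j => a ((pairComposition h0 hi).sizeUpTo α + j))) =
          (suspExponent deg (List.range' 0 p)).negOnePow •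
            (A.parity (h.twisting ((List.range' 0 i).map a)) *
              h.twisting ((List.range' i (p - i)).map a)) := by
        intro i h0 hi
        have h1 : A.operations (pairComposition h0 hi).length (fun α => h.modelMap
            ((pairComposition h0 hi).blocksFun α)
            (fun j => a ((pairComposition h0 hi).sizeUpTo α + j))) =
            h.modelMap i (fun j => a (0 + j)) * h.modelMap (p - i) (fun j => a (i + j)) :=
          A.operations_two _
        have h2 : morphismExponent (pairComposition h0 hi) deg =
            (1 - (i : ℤ)) + (1 - ((p - i : ℕ) : ℤ)) * ((List.range' 0 i).map deg).sum := by
          rw [sum_map_range']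
          change (∑ α : Fin 2, ∑ β : Fin 2, if α < β then _ else 0) = _
          rw [Fin.sum_univ_two, Fin.sum_univ_two, Fin.sum_univ_two]
          simp
          rfl
        have hpar := DGCA.parity_of_mem (twisting_mem ha (List.range' 0 i))
        have hsp : List.range' 0 p = List.range' 0 i ++ List.range' i (p - i) := by
          conv_rhs => rw [show List.range' i (p - i) = List.range' (0 + i) (p - i) by simp]
          rw [List.range'_append_1]; congr 1; omega
        rw [h1, h2, hf, hf, hpar, smul_mul_smul_comm, smul_mul_assoc, smul_smul, smul_smul, hsp,
          suspExponent_append, ← Int.negOnePow_add, ← Int.negOnePow_add, ← Int.negOnePow_add]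
        congr 1
        rw [Int.negOnePow_eq_iff]
        simp only [List.length_range']
        refine ⟨-((p - i : ℕ) : ℤ) * ((List.range' 0 i).map deg).sum, ?_⟩
        ring
      simp only [h3]
      rw [← Finset.smul_sum]
      congr 1
      obtain ⟨q, rfl⟩ : ∃ q, p = q + 1 := ⟨p - 1, by omega⟩
      rw [cupSq, splitSum_map, splitSum_range', Finset.sum_range_succ', Finset.sum_range_succ]
      simp only [zero_add, List.range'_zero, List.map_nil, twisting_nil, map_zero, zero_mul,
        Nat.sub_self, mul_zero, add_zero]
      exact Fin.sum_univ_eq_sum_range (fun i =>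
        A.parity (h.twisting ((List.range' 0 (i + 1)).map a)) *
          h.twisting ((List.range' (i + 1) (q + 1 - (i + 1))).map a)) q
  · intro c h1 h2
    have h0 : c.length ≠ 0 := by
      have := c.length_pos_of_pos (by omega)
      omega
    have : A.operations c.length = 0 := by
      generalize c.length = m at h0 h1 h2
      match m with
      | 0 => exact absurd rfl h0
      | 1 => exact absurd rfl h1
      | 2 => exact absurd rfl h2
      | m + 3 => rfl
    rw [this]
    simp

variable (h)

theorem model_one : h.model 1 = 0 := by
  ext a
  simp [model, IsSlotLinear.operations_apply]

theorem isCInfinityAlgebra_model : IsCInfinityAlgebra h.harmonicGr h.model where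
  isInternal := h.harmonicGr_isInternal
  zero := by
    ext a
    simp [model, IsSlotLinear.operations_apply]
  degree k deg a ha := by
    have h1 : h.model k a = _ := h.isSlotLinear_transferred.operations_apply_letters
      (fun i => harmonicParity_of_mem (ha i)) id
    rw [h1, Units.smul_def]
    have := transferred_mem ha (List.ofFn (id : Fin k → Fin k))
    simp only [List.map_ofFn, Function.comp_id, List.sum_ofFn, List.length_ofFn] at this ⊢
    exact zsmul_mem this _
  stasheff p deg a hp ha := by
    refine (sum_insertOp h.isSlotLinear_transferred ha p).trans ?_
    rw [insertSum_transferred, smul_zero]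
  shuffle := h.isSlotLinear_transferred.vanishesOnShuffles
    (fun i x hx => harmonicParity_of_mem hx)
    fun k val deg hval x u y v => shuffleSum_transferred hval x u y v

theorem isCInfinityMorphism_modelMap :
    IsCInfinityMorphism h.harmonicGr h.model A.gr A.operations h.modelMap where
  zero := by
    ext a
    simp [modelMap, IsSlotLinear.operations_apply]
  degree k deg a ha := by
    have h1 : h.modelMap k a = _ := h.isSlotLinear_twisting.operations_apply_letters
      (fun i => harmonicParity_of_mem (ha i)) id
    rw [h1, Units.smul_def]
    have := twisting_mem ha (List.ofFn (id : Fin k → Fin k))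
    simp only [List.map_ofFn, Function.comp_id, List.sum_ofFn, List.length_ofFn] at this ⊢
    exact zsmul_mem this _
  equation p deg a hp ha := by
    rw [sum_composition_operations ha hp, ← insertSum_twisting]
    exact sum_insertOp h.isSlotLinear_twisting ha p
  shuffle := h.isSlotLinear_twisting.vanishesOnShuffles
    (fun i x hx => harmonicParity_of_mem hx)
    fun k val deg hval x u y v => shuffleSum_twisting hval x u y v

theorem harmonicParity_one : h.harmonicParity h.harmonicOne = h.harmonicOne :=
  Subtype.ext (DGCA.parity_one _)

theorem harmonicOne_mem_ofFn {k : ℕ} {a : Fin k → h.harmonic} (ha : ∃ i, a i = h.harmonicOne) :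
    h.harmonicOne ∈ List.ofFn fun j => (h.harmonicParity ^ (k - 1 - (j : ℕ))) (a j) := by
  obtain ⟨i, hi⟩ := ha
  rw [List.mem_ofFn]
  refine ⟨i, ?_⟩
  rw [hi]
  induction k - 1 - (i : ℕ) with
  | zero => rfl
  | succ m ih => rw [pow_succ', Module.End.mul_apply, ih, harmonicParity_one]

theorem model_two (α β : h.harmonic) :
    h.model 2 ![α, β] = h.toHarmonic ((α : A.carrier) * (β : A.carrier)) := by
  simp [model, IsSlotLinear.operations_apply, transferred, cupSq, splitSum, DGCA.parity_parity,
    List.ofFn_succ]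

theorem modelMap_one (a : Fin 1 → h.harmonic) : h.modelMap 1 a = a 0 := by
  simp [modelMap, IsSlotLinear.operations_apply, List.ofFn_succ]

theorem isUnital_model : IsUnital h.harmonicGr h.model h.harmonicOne where
  mem := SetLike.GradedOne.one_mem (A := A.gr)
  unary := by rw [model_one]; rfl
  left a := by
    rw [model_two]
    ext
    rw [coe_toHarmonic, show (h.harmonicOne : A.carrier) = 1 from rfl, one_mul, proj_coe]
  right a := by
    rw [model_two]
    ext
    rw [coe_toHarmonic, show (h.harmonicOne : A.carrier) = 1 from rfl, mul_one, proj_coe]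
  higher k hk a ha :=
    h.transferred_eq_zero_of_one_mem (h.harmonicOne_mem_ofFn ha) (by simpa using hk)

theorem isUnitalCInfinityQuasiIso_modelMap : IsUnitalCInfinityQuasiIso h.harmonicGr h.model
    h.harmonicOne A.gr A.operations 1 h.modelMap where
  isMorphism := h.isCInfinityMorphism_modelMap
  isUnital :=
    { unary := h.modelMap_one _
      higher := fun k hk a ha =>
        h.twisting_eq_zero_of_one_mem (h.harmonicOne_mem_ofFn ha) (by simpa using hk) }
  quasiIso := by
    have h1 : ∀ x, h.modelMap.unary x = x := fun x => h.modelMap_one _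
    have h2 : ∀ a, A.operations.unary a = A.d a := fun a => A.operations_one _
    have h3 : ∀ x, h.model.unary x = 0 := fun x => by
      change h.model 1 _ = 0
      rw [model_one]; rfl
    constructor
    · intro x
      rw [h1, h2, h1, h3, d_coe]; rfl
    · rintro x - ⟨y, hy⟩
      rw [h1, h2] at hy
      exact ⟨0, by rw [map_zero, h.eq_zero_of_coe_eq_d hy]⟩
    · intro y hy
      rw [h2] at hy
      refine ⟨h.toHarmonic y, h3 _, h.δ y, ?_⟩
      rw [h1, h2, coe_toHarmonic, proj_apply, hy, map_zero]
      abel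

theorem model_eq_zero {r k : ℕ} (hr : 2 ≤ r) (hA : A.IsConnected (r - 1)) (hk : 3 ≤ k)
    (hn : n ≤ (k + 1) * (r - 1) + 2) : h.model k = 0 := by
  refine MultilinearMap.eq_zero_of_homogeneous h.harmonicGr_isInternal _ fun deg a ha => ?_
  have h1 : h.model k a = _ := h.isSlotLinear_transferred.operations_apply_letters
    (fun i => harmonicParity_of_mem (ha i)) id
  rw [h1, transferred_eq_zero hr hA ha (by simpa using hk) (by simpa using hn), smul_zero]

end HodgeHomotopy

end PoincareDGCA

/-! ### Formality -/

namespace DGCA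

variable {K : Type u} [Field K] (A : DGCA.{u, v} K)

/-- The sub-DGCA on a graded subalgebra which is closed under the differential. -/
noncomputable def sub (S : Subalgebra K A.carrier)
    (hS : ∀ x ∈ S, ∀ i, (A.component i x : A.carrier) ∈ S) (hd : ∀ x ∈ S, A.d x ∈ S) :
    DGCA.{u, v} K :=
  let 𝒮 : ℤ → Submodule K S := fun i => (A.gr i).comap S.val.toLinearMap
  have hint : DirectSum.IsInternal 𝒮 :=
    A.isInternal_comap (Subalgebra.toSubmodule S) hS 𝒮 fun _ _ => Iff.rfl
  letI : SetLike.GradedMonoid 𝒮 :=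
    { one_mem := SetLike.GradedOne.one_mem (A := A.gr)
      mul_mem := fun _ _ _ _ ha hb => SetLike.GradedMul.mul_mem (A := A.gr) ha hb }
  letI : DirectSum.Decomposition 𝒮 := hint.chooseDecomposition
  letI : GradedAlgebra 𝒮 := {}
  { carrier := S
    gr := 𝒮
    d := A.d.restrict (p := Subalgebra.toSubmodule S) (q := Subalgebra.toSubmodule S) hd
    gr_neg := fun i hi => by
      rw [eq_bot_iff]
      intro x hx
      have hx' : (x : A.carrier) ∈ A.gr i := hx
      rw [A.gr_neg i hi] at hx'
      exact Subtype.ext hx'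
    mul_comm_gr := fun i j a b ha hb => Subtype.ext (A.mul_comm_gr i j a b ha hb)
    d_mem := fun i a ha => A.d_mem i a ha
    d_d := fun a => Subtype.ext (A.d_d a)
    leibniz := fun i a b ha => Subtype.ext (A.leibniz i a b ha) }

theorem component_component (i j : ℤ) (a : A.carrier) :
    (A.component i (A.component j a : A.carrier) : A.carrier) =
      if j = i then (A.component i a : A.carrier) else 0 := by
  split_ifs with h
  · subst h
    exact decompose_of_mem_same _ (A.component j a).2
  · exact decompose_of_mem_ne _ (A.component j a).2 h

open Classical in
theorem sum_component (a : A.carrier) :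
    ∑ i ∈ (decompose A.gr a).support, (A.component i a : A.carrier) = a :=
  sum_support_decompose A.gr a

/-- The elements whose components of degree less than `j` vanish. -/
noncomputable def degreeGE (j : ℤ) : Submodule K A.carrier :=
  ⨅ i : {i : ℤ // i < j}, LinearMap.ker (A.component i)

variable {A}

theorem mem_degreeGE {j : ℤ} {a : A.carrier} :
    a ∈ A.degreeGE j ↔ ∀ i < j, (A.component i a : A.carrier) = 0 := by
  simp [degreeGE]

theorem mem_degreeGE_of_mem {i j : ℤ} {a : A.carrier} (ha : a ∈ A.gr i) (hij : j ≤ i) :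
    a ∈ A.degreeGE j :=
  mem_degreeGE.2 fun k hk => decompose_of_mem_ne _ ha (by omega)

theorem eq_zero_of_mem_degreeGE {i j : ℤ} {a : A.carrier} (ha : a ∈ A.gr i)
    (h : a ∈ A.degreeGE j) (hij : i < j) : a = 0 := by
  rw [← mem_degreeGE.1 h i hij]
  exact (decompose_of_mem_same _ ha).symm

theorem component_mem_degreeGE {j : ℤ} {a : A.carrier} (h : a ∈ A.degreeGE j) (i : ℤ) :
    (A.component i a : A.carrier) ∈ A.degreeGE j := by
  rw [mem_degreeGE] at *
  intro k hk
  rw [component_component]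
  split_ifs
  · exact h k hk
  · rfl

end DGCA

namespace PoincareDGCA

theorem pairing_d_left {K : Type u} [Field K] {n : ℕ} {A : PoincareDGCA.{u, v} K n}
    (a b : A.carrier) : A.pairing (A.d a) b = -A.pairing (A.parity a) (A.d b) := by
  have h := integral_topClass_d (A := A) (a * b)
  rw [DGCA.d_mul, map_add, map_add, map_add] at h
  exact eq_neg_of_add_eq_zero_left h

namespace HodgeHomotopy

variable {K : Type u} [Field K] {n : ℕ} {A : PoincareDGCA.{u, v} K n} (h : A.HodgeHomotopy)

/-- The elements which are harmonic up to degree `2 r - 2` and lie in `ker δ` in degree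
`2 r - 1`. -/
noncomputable def smallSubmodule (r : ℕ) : Submodule K A.carrier :=
  (A.degreeGE (2 * r - 1)).comap h.δ ⊓ (A.degreeGE (2 * r)).comap A.d

variable {h} {r : ℕ}

theorem mem_smallSubmodule {a : A.carrier} : a ∈ h.smallSubmodule r ↔
    h.δ a ∈ A.degreeGE (2 * r - 1) ∧ A.d a ∈ A.degreeGE (2 * r) := Iff.rfl

theorem component_mem_smallSubmodule {a : A.carrier} (ha : a ∈ h.smallSubmodule r) (i : ℤ) :
    (A.component i a : A.carrier) ∈ h.smallSubmodule r := by
  refine mem_smallSubmodule.2 ⟨?_, ?_⟩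
  · rw [δ_component]
    exact DGCA.component_mem_degreeGE ha.1 _
  · rw [DGCA.d_component]
    exact DGCA.component_mem_degreeGE ha.2 _

theorem coe_mem_smallSubmodule (x : h.harmonic) : (x : A.carrier) ∈ h.smallSubmodule r := by
  refine mem_smallSubmodule.2 ⟨?_, ?_⟩
  · rw [δ_coe]; exact zero_mem _
  · rw [d_coe]; exact zero_mem _

theorem δ_eq_zero_of_mem_small {a : A.carrier} (ha : a ∈ h.smallSubmodule r) {i : ℤ}
    (hi : a ∈ A.gr i) (hir : i < 2 * r) : h.δ a = 0 :=
  DGCA.eq_zero_of_mem_degreeGE (h.δ_mem _ _ hi) ha.1 (by omega)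

theorem d_eq_zero_of_mem_small {a : A.carrier} (ha : a ∈ h.smallSubmodule r) {i : ℤ}
    (hi : a ∈ A.gr i) (hir : i < 2 * r - 1) : A.d a = 0 :=
  DGCA.eq_zero_of_mem_degreeGE (A.d_mem _ _ hi) ha.2 (by omega)

/-- The small subalgebra is connected on the nose: apart from the multiples of the unit, its
homogeneous elements have degree at least `r`. -/
theorem small_cases (hr : 2 ≤ r) (hA : A.IsConnected (r - 1)) {a : A.carrier}
    (ha : a ∈ h.smallSubmodule r) {i : ℤ} (hi : a ∈ A.gr i) :
    (∃ t : K, a = t • (1 : A.carrier)) ∨ (r : ℤ) ≤ i := by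
  by_cases hir : (r : ℤ) ≤ i
  · exact Or.inr hir
  refine Or.inl ?_
  have hharm : a ∈ h.harmonic := by
    rw [mem_harmonic_iff, proj_apply, δ_eq_zero_of_mem_small ha hi (by omega),
      d_eq_zero_of_mem_small ha hi (by omega)]
    simp
  lift a to h.harmonic using hharm
  rcases lt_trichotomy i 0 with h0 | h0 | h0
  · rw [A.gr_neg i h0, Submodule.mem_bot] at hi
    exact ⟨0, by rw [hi, zero_smul]⟩
  · subst h0
    obtain ⟨t, ht⟩ := h.exists_eq_smul_one hA (x := a) hi
    exact ⟨t, congrArg Subtype.val ht⟩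
  · have := hA.pos i.toNat (by omega) (by omega)
    rw [Int.toNat_of_nonneg h0.le] at this
    exact ⟨0, by rw [h.harmonic_eq_zero this (x := a) hi, zero_smul]; rfl⟩

/-- Products of elements of degree at least `r` have degree at least `2 r`, where `smallSubmodule`
imposes no condition. -/
theorem mul_mem_smallSubmodule (hr : 2 ≤ r) (hA : A.IsConnected (r - 1)) {a b : A.carrier}
    (ha : a ∈ h.smallSubmodule r) (hb : b ∈ h.smallSubmodule r) :
    a * b ∈ h.smallSubmodule r := by
  rw [← A.sum_component a, ← A.sum_component b, Finset.sum_mul_sum]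
  refine sum_mem fun i _ => sum_mem fun j _ => ?_
  have ha' := component_mem_smallSubmodule ha i
  have hb' := component_mem_smallSubmodule hb j
  have hai := (A.component i a).2
  have hbj := (A.component j b).2
  rcases small_cases hr hA ha' hai with ⟨t, ht⟩ | hi
  · rw [ht, smul_mul_assoc, one_mul]
    exact Submodule.smul_mem _ _ hb'
  rcases small_cases hr hA hb' hbj with ⟨t, ht⟩ | hj
  · rw [ht, mul_smul_comm, mul_one]
    exact Submodule.smul_mem _ _ ha'
  have hab := SetLike.GradedMul.mul_mem hai hbj
  exact ⟨DGCA.mem_degreeGE_of_mem (h.δ_mem _ _ hab) (by omega),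
    DGCA.mem_degreeGE_of_mem (A.d_mem _ _ hab) (by omega)⟩

variable (h) in
/-- The subalgebra formed by `smallSubmodule`. -/
noncomputable def smallSubalgebra (hr : 2 ≤ r) (hA : A.IsConnected (r - 1)) :
    Subalgebra K A.carrier :=
  (h.smallSubmodule r).toSubalgebra (coe_mem_smallSubmodule h.harmonicOne)
    fun _ _ => mul_mem_smallSubmodule hr hA

theorem d_mem_smallSubmodule {a : A.carrier} (ha : a ∈ h.smallSubmodule r) :
    A.d a ∈ h.smallSubmodule r := by
  refine mem_smallSubmodule.2 ⟨?_, ?_⟩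
  · refine DGCA.mem_degreeGE.2 fun i hi => ?_
    have h1 := h.δ_component (i + 1) (A.d a)
    rw [add_sub_cancel_right] at h1
    rw [← h1, DGCA.mem_degreeGE.1 ha.2 _ (by omega), map_zero]
  · rw [A.d_d]; exact zero_mem _

theorem δ_mem_smallSubmodule {a : A.carrier} (ha : a ∈ h.smallSubmodule r) :
    h.δ a ∈ h.smallSubmodule r := by
  refine mem_smallSubmodule.2 ⟨?_, ?_⟩
  · rw [h.δ_δ]; exact zero_mem _
  · refine DGCA.mem_degreeGE.2 fun i hi => ?_
    have h1 := A.d_component (i - 1) (h.δ a)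
    rw [sub_add_cancel] at h1
    rw [← h1, DGCA.mem_degreeGE.1 ha.1 _ (by omega), map_zero]

/-- A homogeneous element of the small subalgebra without harmonic part lives in degree at least
`2 r - 1`, so its products have harmonic part zero, except possibly in top degree. There the pairing
of its exact and coexact parts with the small subalgebra vanishes, since `n ≤ 4 r - 2`. -/
theorem proj_mul_eq_zero (hr : 2 ≤ r) (hA : A.IsConnected (r - 1)) (hn : n ≤ 4 * r - 2)
    {a b : A.carrier} (ha : a ∈ h.smallSubmodule r) (hb : b ∈ h.smallSubmodule r) {i j : ℤ}
    (hai : a ∈ A.gr i) (hbj : b ∈ A.gr j) (hj : r ≤ j) (h0 : h.proj a = 0) :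
    h.proj (a * b) = 0 := by
  have hae : a = A.d (h.δ a) + h.δ (A.d a) := by
    rw [proj_apply, sub_eq_zero] at h0; exact h0
  have hbe : b = h.proj b + (A.d (h.δ b) + h.δ (A.d b)) := by
    rw [proj_apply]; abel
  by_cases hi : i < 2 * r - 1
  · rw [hae, δ_eq_zero_of_mem_small ha hai (by omega), d_eq_zero_of_mem_small ha hai hi]
    simp
  have hab := SetLike.GradedMul.mul_mem hai hbj
  have hpm : h.toHarmonic (a * b) ∈ h.harmonicGr (i + j) := h.proj_mem hab
  suffices h.toHarmonic (a * b) = 0 from congrArg Subtype.val this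
  rcases lt_trichotomy (i + j) (n : ℤ) with hlt | heq | hgt
  · exact h.harmonic_eq_zero (cohGr_eq_bot hA (by omega) hlt) hpm
  · change a * b ∈ A.gr (i + j) at hab
    rw [heq] at hab hpm
    refine h.eq_zero_of_integral_eq_zero hA hpm ?_
    rw [coe_toHarmonic, integral_proj _ hab]
    change A.pairing a b = 0
    have hl : ∀ x y z, A.pairing (x + y) z = A.pairing x z + A.pairing y z := fun x y z => by
      simp [pairing, add_mul]
    have hr' : ∀ x y z, A.pairing x (y + z) = A.pairing x y + A.pairing x z := fun x y z => by
      simp [pairing, mul_add]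
    have hz : ∀ x, A.pairing x 0 = 0 := fun x => by simp [pairing]
    have hz' : ∀ x, A.pairing 0 x = 0 := fun x => by simp [pairing]
    rw [hae, hbe, hl, hr', hr', hr', hr', pairing_d_left, pairing_d_left, d_proj, A.d_d,
      h.pairing_δ_δ, hz]
    have h3 : A.pairing (h.δ (A.d a)) (h.proj b) = 0 :=
      h.pairing_δ_coe (x := h.toHarmonic b) (h.proj_mem hbj) (h.δ_mem _ _ (A.d_mem _ _ hai))
    have h1 : A.pairing (A.d (h.δ a)) (h.δ (A.d b)) = 0 := by
      by_cases hi2 : i < 2 * r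
      · rw [δ_eq_zero_of_mem_small ha hai hi2, map_zero, hz']
      · rw [d_eq_zero_of_mem_small hb hbj (by omega), map_zero, hz]
    have h2 : A.pairing (h.δ (A.d a)) (A.d (h.δ b)) = 0 := by
      by_cases hj2 : j < 2 * r
      · rw [δ_eq_zero_of_mem_small hb hbj hj2, map_zero, hz]
      · rw [d_eq_zero_of_mem_small ha hai (by omega), map_zero, hz']
    rw [h1, h2, h3]
    simp
  · have := hpm
    rw [harmonicGr, A.gr_above _ hgt] at this
    exact Subtype.ext ((Submodule.mem_bot K).1 this)

/-- On the small subalgebra the harmonic projection is multiplicative. -/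
theorem proj_mul (hr : 2 ≤ r) (hA : A.IsConnected (r - 1)) (hn : n ≤ 4 * r - 2)
    {a b : A.carrier} (ha : a ∈ h.smallSubmodule r) (hb : b ∈ h.smallSubmodule r) :
    h.proj (a * b) = h.proj (h.proj a * h.proj b) := by
  rw [← A.sum_component a, ← A.sum_component b, map_sum, map_sum, Finset.sum_mul_sum,
    Finset.sum_mul_sum, map_sum, map_sum]
  refine Finset.sum_congr rfl fun i _ => ?_
  rw [map_sum, map_sum]
  refine Finset.sum_congr rfl fun j _ => ?_
  have ha' := component_mem_smallSubmodule ha i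
  have hb' := component_mem_smallSubmodule hb j
  have hai := (A.component i a).2
  have hbj := (A.component j b).2
  generalize (A.component i a : A.carrier) = x at *
  generalize (A.component j b : A.carrier) = y at *
  rcases small_cases hr hA ha' hai with ⟨t, rfl⟩ | hi
  · simp [proj_one, proj_proj]
  rcases small_cases hr hA hb' hbj with ⟨t, rfl⟩ | hj
  · simp [proj_one, proj_proj]
  have hpx : h.proj x ∈ h.smallSubmodule r := coe_mem_smallSubmodule (h.toHarmonic x)
  have hpy : h.proj y ∈ h.smallSubmodule r := coe_mem_smallSubmodule (h.toHarmonic y)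
  have h1 : h.proj ((x - h.proj x) * y) = 0 :=
    proj_mul_eq_zero hr hA hn (sub_mem ha' hpx) hb' (sub_mem hai (h.proj_mem hai)) hbj hj
      (by rw [map_sub, proj_proj, sub_self])
  have h2 : h.proj ((y - h.proj y) * h.proj x) = 0 :=
    proj_mul_eq_zero hr hA hn (sub_mem hb' hpy) hpx (sub_mem hbj (h.proj_mem hbj))
      (h.proj_mem hai) hi (by rw [map_sub, proj_proj, sub_self])
  have h3 : h.proj (h.proj x * (y - h.proj y)) = 0 := by
    rw [A.mul_comm_gr i j _ _ (h.proj_mem hai) (sub_mem hbj (h.proj_mem hbj)), map_units_int_smul,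
      h2, smul_zero]
  rw [← sub_eq_zero, ← map_sub, ← add_zero (0 : A.carrier)]
  nth_rewrite 1 [← h1]
  rw [← h3, ← map_add]
  congr 1
  noncomm_ring

/-- The zig-zag is `A ← B → H(A)`, with `B` the small subalgebra and `B → H(A)` the class of the
harmonic part. -/
theorem isFormal (h : A.HodgeHomotopy) (hr : 2 ≤ r) (hA : A.IsConnected (r - 1))
    (hn : n ≤ 4 * r - 2) : A.IsFormal := by
  let B : DGCA.{u, v} K := A.sub (h.smallSubalgebra hr hA)
    (fun x hx i => component_mem_smallSubmodule hx i) fun x hx => d_mem_smallSubmodule hx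
  have hBA : DGCA.HasQuasiIso B A.toDGCA := by
    refine ⟨⟨(h.smallSubalgebra hr hA).val, fun i a ha => ha, fun a => rfl⟩, fun _ => rfl, ?_, ?_⟩
    · rintro (x : h.smallSubalgebra hr hA) - ⟨y, hy⟩
      have hx : A.d (h.δ (x : A.carrier)) = x := by
        change A.d y = (x : A.carrier) at hy
        rw [← hy, h.d_δ_d]
      exact ⟨⟨h.δ x, δ_mem_smallSubmodule x.2⟩, Subtype.ext hx⟩
    · intro y hy
      refine ⟨⟨h.proj y, coe_mem_smallSubmodule (h.toHarmonic y)⟩, Subtype.ext (h.d_proj y),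
        h.δ y, ?_⟩
      change A.d (h.δ y) = y - h.proj y
      rw [proj_apply, hy, map_zero]
      abel
  let π : A.carrier →ₗ[K] A.cocycles := h.proj.codRestrict (Subalgebra.toSubmodule A.cocycles)
    h.d_proj
  let φ : B.carrier →ₗ[K] A.Coh := A.cls.toLinearMap ∘ₗ π ∘ₗ
    (h.smallSubalgebra hr hA).val.toLinearMap
  have hφ1 : φ 1 = 1 := by
    have : π 1 = 1 := Subtype.ext h.proj_one
    change A.cls (π 1) = 1
    rw [this, map_one]
  have hφm : ∀ a b, φ (a * b) = φ a * φ b := by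
    intro (a : h.smallSubalgebra hr hA) (b : h.smallSubalgebra hr hA)
    change A.cls (π ((a : A.carrier) * (b : A.carrier))) = A.cls (π a) * A.cls (π b)
    rw [← map_mul, ← sub_eq_zero, ← map_sub, DGCA.cls_eq_zero_iff]
    refine ⟨-h.δ (h.proj a * h.proj b), ?_⟩
    have hd : A.d (h.proj a * h.proj b) = 0 := by simp [DGCA.d_mul, d_proj]
    change _ = h.proj ((a : A.carrier) * (b : A.carrier)) - h.proj a * h.proj b
    rw [proj_mul hr hA hn a.2 b.2, proj_apply _ (_ * _), hd, map_zero, map_neg]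
    abel
  have hBH : DGCA.HasQuasiIso B A.cohomology := by
    refine ⟨⟨AlgHom.ofLinearMap φ hφ1 hφm, ?_, ?_⟩, ?_, ?_, ?_⟩
    · intro i (a : h.smallSubalgebra hr hA) ha
      exact ⟨π a, h.proj_mem ha, rfl⟩
    · intro (a : h.smallSubalgebra hr hA)
      change A.cls (π (A.d a)) = 0
      rw [show π (A.d a) = 0 from Subtype.ext (h.proj_d _), map_zero]
    · intro (a : h.smallSubalgebra hr hA)
      change A.cls (π (A.d a)) = 0
      rw [show π (A.d a) = 0 from Subtype.ext (h.proj_d _), map_zero]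
    · rintro (x : h.smallSubalgebra hr hA) hx ⟨y, hy⟩
      replace hx : A.d (x : A.carrier) = 0 := congrArg Subtype.val hx
      replace hy : 0 = A.cls (π x) := hy
      obtain ⟨c, hc⟩ := (A.cls_eq_zero_iff _).1 hy.symm
      have h0 : h.proj x = 0 :=
        congrArg Subtype.val (h.eq_zero_of_coe_eq_d (x := h.toHarmonic x) hc)
      have hx' : A.d (h.δ (x : A.carrier)) = x := by
        rw [proj_apply, hx, map_zero, add_zero, sub_eq_zero] at h0
        exact h0.symm
      exact ⟨⟨h.δ x, δ_mem_smallSubmodule x.2⟩, Subtype.ext hx'⟩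
    · intro y _
      obtain ⟨z, rfl⟩ := A.cls_surjective y
      refine ⟨⟨h.proj z, coe_mem_smallSubmodule (h.toHarmonic z)⟩, Subtype.ext (h.d_proj z),
        0, ?_⟩
      change 0 = A.cls z - A.cls (π (h.proj z))
      rw [eq_comm, ← map_sub, DGCA.cls_eq_zero_iff]
      refine ⟨h.δ z, ?_⟩
      change _ = (z : A.carrier) - h.proj (h.proj z)
      rw [proj_proj, proj_apply, show A.d (z : A.carrier) = 0 from z.2, map_zero]
      abel
  exact Relation.EqvGen.trans _ _ _ (Relation.EqvGen.symm _ _ (Relation.EqvGen.rel _ _ hBA))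
    (Relation.EqvGen.rel _ _ hBH)

end HodgeHomotopy

end PoincareDGCA

theorem mainTheorem1 {K : Type u} [Field K] {n r ℓ : ℕ} (hr : 2 ≤ r) (hℓ : 4 ≤ ℓ)
    (A : PoincareDGCA.{u, v} K n) (hA : A.IsConnected (r - 1)) (h : A.HodgeHomotopy)
    (hn : n ≤ ℓ * (r - 1) + 2) :
    (∃ m : Operations K h.harmonic h.harmonic,
      IsCInfinityAlgebra h.harmonicGr m ∧
      IsMinimal m ∧
      IsUnital h.harmonicGr m h.harmonicOne ∧
      (∃ f : Operations K h.harmonic A.carrier,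
        IsUnitalCInfinityQuasiIso h.harmonicGr m h.harmonicOne A.gr A.operations 1 f) ∧
      (∀ α β : h.harmonic, m 2 ![α, β] = h.toHarmonic ((α : A.carrier) * (β : A.carrier))) ∧
      (∀ k, ℓ - 1 ≤ k → m k = 0) ∧
      (n ≤ 6 * r - 4 → ∀ k, 5 ≤ k → m k = 0) ∧
      (n ≤ 5 * r - 3 → ∀ k, 4 ≤ k → m k = 0) ∧
      (n ≤ 4 * r - 2 → ∀ k, 3 ≤ k → m k = 0)) ∧
    (n ≤ 4 * r - 2 → A.IsFormal) := by
  have hvanish : ∀ ℓ' k, 4 ≤ ℓ' → n ≤ ℓ' * (r - 1) + 2 → ℓ' - 1 ≤ k → h.model k = 0 := by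
    intro ℓ' k h4 hn' hk
    refine h.model_eq_zero hr hA (by omega) (hn'.trans ?_)
    gcongr
    omega
  exact ⟨⟨h.model, h.isCInfinityAlgebra_model, h.model_one, h.isUnital_model,
    ⟨h.modelMap, h.isUnitalCInfinityQuasiIso_modelMap⟩, h.model_two,
    fun k hk => hvanish ℓ k hℓ hn hk,
    fun hn' k hk => hvanish 6 k (by norm_num) (by omega) (by omega),
    fun hn' k hk => hvanish 5 k (by norm_num) (by omega) (by omega),
    fun hn' k hk => hvanish 4 k (by norm_num) (by omega) (by omega)⟩,
    h.isFormal hr hA⟩
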